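/- Let $\Omega\subset\mathbb R^2$ be a bounded polygonal domain with outward unit normal $n$, and let $\alpha>0$. Write $\|\cdot\|$ and $(\cdot,\cdot)$ for the norm and inner product of $L_2(\Omega)$ and $\|\cdot\|_S$ for the norm of $L_2(S)$. Put $$Q=\{p\in H^2(\Omega):\ \partial p/\partial n=0\ \text{on}\ \partial\Omega\},\qquad V=H^2_0(\Omega),\qquad a(p,r)=\int_\Omega\Delta p\,\Delta r\,dx .$$ For $f,u_d\in L_2(\Omega)$ let $(q,u,\phi)\in Q\times Q\times V$ (optimal control, optimal state, adjoint state) be the solution of the optimality system $$u=u_f+q,\quad u_f\in V,\qquad a(u_f,v)=(f,v)-a(q,v),\qquad a(\phi,v)=(u-u_d,v)\qquad\forall v\in V,$$ $$\alpha\,a(q,p)=a(p,\phi)-(u-u_d,p)\qquad\forall p\in Q .$$ Let $\mathcal T_h$ be a conforming triangulation of $\Omega$ with set of edges $\mathcal E_h$, $|e|$ the length of $e\in\mathcal E_h$, and $\sigma\ge1$. Let $Q_h=\{p\in H^1(\Omega): p|_T\in P_2(T)\ \forall T\in\mathcal T_h\}$ and $V_h=\{v\in H^1_0(\Omega): v|_T\in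 P_2(T)\ \forall T\in\mathcal T_h\}$. On an interior edge $e=\partial T_+\cap\partial T_-$ let $[\partial v/\partial n]=\nabla v_+\cdot n_++\nabla v_-\cdot n_-$ and $\{\Delta v\}=\tfrac12(\Delta v_++\Delta v_-)$, where $v_\pm=v|_{T_\pm}$ and $n_\pm$ is the unit normal on $e$ pointing out of $T_\pm$; on a boundary edge let $[\partial v/\partial n]=\nabla v\cdot n$ and $\{\Delta v\}=\Delta v$. Put $\tilde a_h(v,w)=\sum_{T\in\mathcal T_h}\int_T\Delta v\,\Delta w\,dx$ and $$a_h(p,r)=\tilde a_h(p,r)+\sum_{e\in\mathcal E_h}\int_e\Big(\{\Delta p\}[\partial r/\partial n]+\{\Delta r\}[\partial p/\partial n]+\frac{\sigma}{|e|}[\partial p/\partial n][\partial r/\partial n]\Big)ds .$$ Let $(q_h,u_h,\phi_h)\in Q_h\times Q_h\times V_h$ be a solution of the discrete system $$u_h=u_f^h+q_h,\quad u_f^h\in V_h,\qquad a_h(u_f^h,v)=(f,v)-a_h(q_h,v),\qquad a_h(\phi_h,v)=(u_h-u_d,v)\qquad\forall v\in V_h,$$ $$\alpha\,a_h(q_h,p)=a_h(\phi_h,p)-(u_h-u_d,p)\qquad\forall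 p\in Q_h .$$ Let $(u_a,q_a,\phi_a)\in H^1(\Omega)\times Q\times V$ be the solution of the auxiliary continuous problems $$u_a=u_f^a+q_h,\quad u_f^a\in V,\qquad a(u_f^a,v)=(f,v)-\tilde a_h(q_h,v),\qquad a(v,\phi_a)=(u_h-u_d,v)\qquad\forall v\in V,$$ $$\alpha\,a(q_a,p)+(q_a,p)=\tilde a_h(p,\phi_h)-(u_f^h-u_d,p)\qquad\forall p\in Q .$$ Finally let $$\|v\|_{2,h}^2=\sum_{T\in\mathcal T_h}\|\Delta v\|_T^2+\|v\|^2,\qquad |||v|||_h^2=\|v\|_{2,h}^2+\sum_{e\in\mathcal E_h}\frac{\sigma}{|e|}\big\|[\partial v/\partial n]\big\|_e^2 .$$ Then there is a constant $C>0$, depending only on $\Omega$ and $\alpha$ (in particular not on $f$, $u_d$, $\mathcal T_h$ and $\sigma$), such that $$|||q-q_h|||_h+|||u-u_h|||_h+|||\phi-\phi_h|||_h\le C\Big[\|q_a-q_h\|_{2,h}+\|u_a-u_h\|_{2,h}+\|\phi_a-\phi_h\|_{2,h}+\sum_{e\in\mathcal E_h}\Big(\frac{\sigma}{|e|}\Big)^{1/2}\Big(\big\|[\partial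 q_h/\partial n]\big\|_e+\big\|[\partial u_h/\partial n]\big\|_e+\big\|[\partial\phi_h/\partial n]\big\|_e\Big)\Big].$$ -/

import Mathlib

open MeasureTheory Set
open scoped ContDiff

noncomputable section

namespace Biharmonic

/-- The Euclidean plane. -/
abbrev Plane := EuclideanSpace ℝ (Fin 2)

/-- The classical partial derivative `∂φ/∂xᵢ` of a differentiable function. -/
def partialDeriv (i : Fin 2) (φ : Plane → ℝ) (x : Plane) : ℝ :=
  fderiv ℝ φ x (EuclideanSpace.single i (1 : ℝ))

/-- Test functions on `U`: smooth functions with compact support contained in `U`. -/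
def IsTestFunction (U : Set Plane) (φ : Plane → ℝ) : Prop :=
  ContDiff ℝ ∞ φ ∧ HasCompactSupport φ ∧ tsupport φ ⊆ U

/-! ### Sobolev spaces on an open set `U`, for functions with values in `F` (`ℝ` or the plane).
Functions are ordinary functions on the plane of which only the values on `U` matter (a.e.). -/

section Sobolev

variable {F : Type} [NormedAddCommGroup F] [NormedSpace ℝ F]

/-- `v ∈ L₂(U)`. -/
def MemL2 (U : Set Plane) (v : Plane → F) : Prop :=
  MemLp v 2 (volume.restrict U)

/-- `w` is a weak partial derivative `∂v/∂xᵢ` on `U`. -/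
def IsWeakPartial (U : Set Plane) (i : Fin 2) (v w : Plane → F) : Prop :=
  ∀ φ : Plane → ℝ, IsTestFunction U φ →
    ∫ x in U, partialDeriv i φ x • v x = -∫ x in U, φ x • w x

open Classical in
/-- The square integrable weak partial derivative of `v` on `U` (unique almost everywhere on `U`);
it is set to `0` if there is none. -/
def weakPartial (U : Set Plane) (i : Fin 2) (v : Plane → F) : Plane → F :=
  if h : ∃ w : Plane → F, MemL2 U w ∧ IsWeakPartial U i v w then h.choose else 0

/-- `v ∈ H¹(U)`. -/
def MemH1 (U : Set Plane) (v : Plane → F) : Prop :=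
  MemL2 U v ∧ ∀ i, ∃ w : Plane → F, MemL2 U w ∧ IsWeakPartial U i v w

end Sobolev

/-- `v ∈ H²(U)`. -/
def MemH2 (U : Set Plane) (v : Plane → ℝ) : Prop :=
  MemH1 U v ∧ ∀ i, MemH1 U (weakPartial U i v)

/-- The weak gradient. -/
def weakGrad (U : Set Plane) (v : Plane → ℝ) (x : Plane) : Plane :=
  WithLp.toLp 2 fun i => weakPartial U i v x

/-- The weak Laplacian. -/
def lap (U : Set Plane) (v : Plane → ℝ) (x : Plane) : ℝ :=
  ∑ i, weakPartial U i (weakPartial U i v) x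

/-- The `L₂(U)` inner product. -/
def l2Inner (U : Set Plane) (v w : Plane → ℝ) : ℝ := ∫ x in U, v x * w x

/-- The square of the `L₂(U)` norm. -/
def l2NormSq (U : Set Plane) (v : Plane → ℝ) : ℝ := ∫ x in U, v x ^ 2

/-- The square of the `H¹(U)` norm. -/
def h1NormSq (U : Set Plane) (v : Plane → ℝ) : ℝ :=
  l2NormSq U v + ∑ i, l2NormSq U (weakPartial U i v)

/-- The square of the `H²(U)` norm. -/
def h2NormSq (U : Set Plane) (v : Plane → ℝ) : ℝ :=
  h1NormSq U v + ∑ i, ∑ j, l2NormSq U (weakPartial U j (weakPartial U i v))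

/-- `v ∈ H¹₀(U)`: the closure of the test functions in `H¹(U)`. -/
def MemH1Zero (U : Set Plane) (v : Plane → ℝ) : Prop :=
  MemH1 U v ∧ ∀ ε : ℝ, 0 < ε → ∃ φ : Plane → ℝ, IsTestFunction U φ ∧ h1NormSq U (v - φ) < ε

/-- `v ∈ H²₀(U)`: the closure of the test functions in `H²(U)`. -/
def MemH2Zero (U : Set Plane) (v : Plane → ℝ) : Prop :=
  MemH2 U v ∧ ∀ ε : ℝ, 0 < ε → ∃ φ : Plane → ℝ, IsTestFunction U φ ∧ h2NormSq U (v - φ) < ε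

/-! ### The domain and the continuous problem -/

/-- Bounded polygonal domains: bounded, connected, nonempty open sets whose boundary is a finite
union of line segments with pairwise disjoint relative interiors, and which lie on one side of
their boundary (no slits). -/
structure IsPolygonalDomain (Ω : Set Plane) : Prop where
  isOpen : IsOpen Ω
  isConnected : IsConnected Ω
  isBounded : Bornology.IsBounded Ω
  interior_closure : interior (closure Ω) = Ω
  boundary : ∃ (l : ℕ) (a b : Fin l → Plane), (∀ k, a k ≠ b k) ∧
    frontier Ω = (⋃ k, segment ℝ (a k) (b k)) ∧
    Pairwise fun k m => Disjoint (openSegment ℝ (a k) (b k)) (openSegment ℝ (a m) (b m))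

/-- `p ∈ Q`: `p ∈ H²(Ω)` with `∂p/∂n = 0` on `∂Ω`. The normal derivative on `∂Ω` is the normal
trace of `∇p`, that is, the functional `φ ↦ ∫_Ω (∇p · ∇φ + Δp φ)` (Green's formula). -/
def MemQ (Ω : Set Plane) (p : Plane → ℝ) : Prop :=
  MemH2 Ω p ∧ ∀ φ : Plane → ℝ, IsTestFunction univ φ →
    ∫ x in Ω, ((∑ i, weakPartial Ω i p x * partialDeriv i φ x) + lap Ω p x * φ x) = 0

/-- `v ∈ V = H²₀(Ω)`. -/
def MemV (Ω : Set Plane) (v : Plane → ℝ) : Prop := MemH2Zero Ω v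

/-- The bilinear form `a(p, r) = ∫_Ω Δp Δr`. -/
def aForm (Ω : Set Plane) (p r : Plane → ℝ) : ℝ := l2Inner Ω (lap Ω p) (lap Ω r)

/-- The triple `(q, u, φ)` (optimal control, optimal state, adjoint state), with `u = u_f + q`,
solves the continuous optimality system. -/
structure IsOptimalTriple (Ω : Set Plane) (α : ℝ) (f ud q u uf φ : Plane → ℝ) : Prop where
  q_mem : MemQ Ω q
  u_mem : MemQ Ω u
  uf_mem : MemV Ω uf
  φ_mem : MemV Ω φ
  u_eq : u =ᵐ[volume.restrict Ω] uf + q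
  state : ∀ v, MemV Ω v → aForm Ω uf v = l2Inner Ω f v - aForm Ω q v
  adjoint : ∀ v, MemV Ω v → aForm Ω φ v = l2Inner Ω (u - ud) v
  optimality : ∀ p, MemQ Ω p → α * aForm Ω q p = aForm Ω p φ - l2Inner Ω (u - ud) p

/-! ### Triangulations and traces on edges.
A triangle or an edge is given by the finite set of its vertices. -/

/-- A simplicial triangulation of `Ω`: a finite (conforming) simplicial complex which fills the
closure of `Ω`. -/
structure Triangulation (Ω : Set Plane) where
  complex : Geometry.SimplicialComplex ℝ Plane
  finite : complex.faces.Finite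
  space_eq : complex.space = closure Ω

/-- The open triangle with vertex set `s`. -/
def cell (s : Finset Plane) : Set Plane := interior (convexHull ℝ (s : Set Plane))

/-- The closed edge with vertex set `e`. -/
def edge (e : Finset Plane) : Set Plane := convexHull ℝ (e : Set Plane)

/-- The length `|e|` of an edge. -/
def edgeLength (e : Finset Plane) : ℝ := Metric.diam (e : Set Plane)

/-- Arc length on an edge. -/
def arc (e : Finset Plane) : Measure Plane := (Measure.hausdorffMeasure 1).restrict (edge e)

/-- `n` is the unit normal of the edge `e` of the triangle `s` which points out of `s`. -/
def IsOutwardNormal (s e : Finset Plane) (n : Plane) : Prop :=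
  ‖n‖ = 1 ∧ (∀ x ∈ e, ∀ y ∈ e, inner ℝ n (x - y) = 0) ∧
    ∀ z ∈ s, z ∉ e → ∀ x ∈ e, inner ℝ n (z - x) < 0

open Classical in
/-- The outward unit normal of the triangle `s` on its edge `e`. -/
def outwardNormal (s e : Finset Plane) : Plane :=
  if h : ∃ n, IsOutwardNormal s e n then h.choose else 0

section Trace

variable {F : Type} [NormedAddCommGroup F] [NormedSpace ℝ F]

/-- `g ∈ L₂(e)` is the trace on the edge `e` of the function `w ∈ H¹(T)`, where `T` is the triangle
with vertex set `s`: Gauss' formula `∫_T ∂ᵢ(φ w) = ∫_e φ g nᵢ` holds for all smooth `φ` that vanish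
near the other two edges of `T`. This determines `g` almost everywhere on `e`. -/
def IsTrace (s e : Finset Plane) (w g : Plane → F) : Prop :=
  MemLp g 2 (arc e) ∧ ∀ φ : Plane → ℝ, IsTestFunction univ φ →
    (∀ e' ⊆ s, e'.card = 2 → e' ≠ e → Disjoint (tsupport φ) (edge e')) →
    ∀ i, ∫ x in cell s, (partialDeriv i φ x • w x + φ x • weakPartial (cell s) i w x) =
      outwardNormal s e i • ∫ x, φ x • g x ∂(arc e)

open Classical in
/-- The trace on the edge `e` of a function in `H¹(T)`, where `T` is the triangle with vertex
set `s`. -/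
def trace (s e : Finset Plane) (w : Plane → F) : Plane → F :=
  if h : ∃ g, IsTrace s e w g then h.choose else 0

end Trace

/-- The outward normal derivative `∇v|_T · n_T` on the edge `e` of the triangle `T` with vertex
set `s`, for `v ∈ H²(T)`. -/
def normalDeriv (s e : Finset Plane) (v : Plane → ℝ) (x : Plane) : ℝ :=
  inner ℝ (trace s e (weakGrad (cell s) v) x) (outwardNormal s e)

/-- `v|_T ∈ P₂(T)` for the triangle `T` with vertex set `s`. -/
def IsQuadraticOn (s : Finset Plane) (v : Plane → ℝ) : Prop :=
  ∃ P : MvPolynomial (Fin 2) ℝ, P.totalDegree ≤ 2 ∧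
    v =ᵐ[volume.restrict (cell s)] fun x => MvPolynomial.eval (fun i => x i) P

/-! ### The discrete problem -/

namespace Triangulation

variable {Ω : Set Plane} (M : Triangulation Ω)

/-- The triangles of the triangulation. -/
def triangles : Finset (Finset Plane) := M.finite.toFinset.filter fun s => s.card = 3

/-- The edges of the triangulation. -/
def edges : Finset (Finset Plane) := M.finite.toFinset.filter fun e => e.card = 2

open Classical in
/-- The triangles that have `e` as an edge: two for an interior edge, one for a boundary edge. -/
def adjacent (e : Finset Plane) : Finset (Finset Plane) := M.triangles.filter fun s => e ⊆ s

/-- The jump of the normal derivative: `∇v₊ · n₊ + ∇v₋ · n₋` on an interior edge and `∇v · nₑ` on a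
boundary edge. -/
def jumpNormalDeriv (e : Finset Plane) (v : Plane → ℝ) (x : Plane) : ℝ :=
  ∑ s ∈ M.adjacent e, normalDeriv s e v x

/-- The average of the Laplacian: `(Δv₊ + Δv₋) / 2` on an interior edge and `Δv` on a boundary
edge. -/
def avgLap (e : Finset Plane) (v : Plane → ℝ) (x : Plane) : ℝ :=
  (∑ s ∈ M.adjacent e, trace s e (lap (cell s) v) x) / ((M.adjacent e).card : ℝ)

/-- `p ∈ Q_h`. -/
def MemQh (p : Plane → ℝ) : Prop := MemH1 Ω p ∧ ∀ s ∈ M.triangles, IsQuadraticOn s p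

/-- `v ∈ V_h`. -/
def MemVh (v : Plane → ℝ) : Prop := MemH1Zero Ω v ∧ ∀ s ∈ M.triangles, IsQuadraticOn s v

/-- The broken bilinear form `∑_T ∫_T Δv Δw`. -/
def aTilde (v w : Plane → ℝ) : ℝ :=
  ∑ s ∈ M.triangles, l2Inner (cell s) (lap (cell s) v) (lap (cell s) w)

/-- The bilinear form `a_h` of the `C⁰` interior penalty method with penalty parameter `σ`. -/
def ah (σ : ℝ) (p r : Plane → ℝ) : ℝ :=
  M.aTilde p r
    + ∑ e ∈ M.edges, ∫ x, M.avgLap e p x * M.jumpNormalDeriv e r x ∂(arc e)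
    + ∑ e ∈ M.edges, ∫ x, M.avgLap e r x * M.jumpNormalDeriv e p x ∂(arc e)
    + ∑ e ∈ M.edges,
        σ / edgeLength e * ∫ x, M.jumpNormalDeriv e p x * M.jumpNormalDeriv e r x ∂(arc e)

/-- `‖[∂v/∂n]‖²` in `L₂(e)`. -/
def jumpNormSq (e : Finset Plane) (v : Plane → ℝ) : ℝ :=
  ∫ x, M.jumpNormalDeriv e v x ^ 2 ∂(arc e)

/-- `‖[∂v/∂n]‖` in `L₂(e)`. -/
def jumpNorm (e : Finset Plane) (v : Plane → ℝ) : ℝ := √(M.jumpNormSq e v)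

/-- The square of the seminorm `|v|_{2,h}`. -/
def seminormTwoSq (v : Plane → ℝ) : ℝ := ∑ s ∈ M.triangles, l2NormSq (cell s) (lap (cell s) v)

/-- The norm `‖v‖_{2,h}`. -/
def normTwo (v : Plane → ℝ) : ℝ := √(M.seminormTwoSq v + l2NormSq Ω v)

/-- The square of the mesh dependent (semi)norm `‖v‖_h`. -/
def normHSq (σ : ℝ) (v : Plane → ℝ) : ℝ :=
  (∑ s ∈ M.triangles, l2NormSq (cell s) (lap (cell s) v))
    + ∑ e ∈ M.edges, σ / edgeLength e * M.jumpNormSq e v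

/-- The energy norm `|||v|||_h`. -/
def energyNorm (σ : ℝ) (v : Plane → ℝ) : ℝ := √(M.normHSq σ v + l2NormSq Ω v)

/-- `(q_h, u_h, φ_h)`, with `u_h = u_f^h + q_h`, solves the discrete optimality system. -/
structure IsDiscreteTriple (σ α : ℝ) (f ud qh uh ufh φh : Plane → ℝ) : Prop where
  qh_mem : M.MemQh qh
  uh_mem : M.MemQh uh
  ufh_mem : M.MemVh ufh
  φh_mem : M.MemVh φh
  uh_eq : uh =ᵐ[volume.restrict Ω] ufh + qh
  state : ∀ v, M.MemVh v → M.ah σ ufh v = l2Inner Ω f v - M.ah σ qh v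
  adjoint : ∀ v, M.MemVh v → M.ah σ φh v = l2Inner Ω (uh - ud) v
  optimality : ∀ p, M.MemQh p → α * M.ah σ qh p = M.ah σ φh p - l2Inner Ω (uh - ud) p

/-- `(q_a, u_a, φ_a)`, with `u_a = u_f^a + q_h`, solves the auxiliary continuous problems with the
discrete functions as data. -/
structure IsAuxiliaryTriple (α : ℝ) (f ud qh uh ufh φh qa ua ufa φa : Plane → ℝ) : Prop where
  qa_mem : MemQ Ω qa
  ua_mem : MemH1 Ω ua
  ufa_mem : MemV Ω ufa
  φa_mem : MemV Ω φa
  ua_eq : ua =ᵐ[volume.restrict Ω] ufa + qh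
  state : ∀ v, MemV Ω v → aForm Ω ufa v = l2Inner Ω f v - M.aTilde qh v
  adjoint : ∀ v, MemV Ω v → aForm Ω v φa = l2Inner Ω (uh - ud) v
  control : ∀ p, MemQ Ω p →
    α * aForm Ω qa p + l2Inner Ω qa p = M.aTilde p φh - l2Inner Ω (ufh - ud) p

end Triangulation

end Biharmonic

end

open Biharmonic

open MeasureTheory Set
open scoped ContDiff

noncomputable section

namespace Biharmonic

/-! The estimate is a stability estimate for the optimality system. The auxiliary functions solve
continuous equations with discrete data. Put e_q = `q - qa`, e_f = `uf - ufa`, e_φ = `φ - φa`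
(errors) and d_q = `qa - qh`, d_u = `ua - uh`, d_φ = `φa - φh` (perturbations, measured by the
right-hand side). Subtracting the equations gives, for v in V and p in Q, with piecewise Laplacians
where needed, (Δe_f, Δv) = -(Δe_q, Δv) - (Δd_q, Δv), (Δe_φ, Δv) = (e_f + e_q + d_q + d_u, v), α
(Δe_q, Δp) + (e_q, p) = (Δp, Δe_φ) + (Δp, Δd_φ) - (e_f + d_u, p). The choices v = e_φ, v = e_f, p =
e_q eliminate the coupling term (Δe_q, Δe_φ). What is left is α‖Δe_q‖² + ‖e_f + e_q‖² on one side
and, on the other, only products of a perturbation with an error. Testing the first equation with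
e_f and the second with e_φ, together with the Poincaré inequality ‖v‖ ≤ C‖Δv‖ on V
(`exists_poincare`), bounds the remaining errors by these two quantities and the perturbations, and
Young's inequality closes the argument (`stability_estimate`). The constant depends on α and the
Poincaré constant alone, so neither the mesh nor σ enters. The triangle inequality then controls the
L₂ and Laplacian parts of the energy norm.

The jumps are handled by `jumpNormSq_sub_le`. Functions in Q, and those in V, which lie in Q by
`MemV.memQ`, have no jump in the normal derivative, so only the discrete function contributes.
Traces are defined through Gauss' formula with default value 0, and two cases suffice. If ∇q has a
trace on an edge from one adjacent triangle, the same function is a trace from the other, and the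
Green functional defining Q makes the normal parts add up to 0. If it has none, then neither has ∇(q
- p) for a piecewise quadratic p, and the jump of q - p is 0 by default. -/

/-! ### Test functions and weak derivatives -/

theorem IsTestFunction.mono {U W : Set Plane} {φ : Plane → ℝ} (h : IsTestFunction U φ)
    (hUW : U ⊆ W) : IsTestFunction W φ :=
  ⟨h.1, h.2.1, h.2.2.trans hUW⟩

theorem IsTestFunction.of_univ {U : Set Plane} {φ : Plane → ℝ} (h : IsTestFunction univ φ)
    (hU : tsupport φ ⊆ U) : IsTestFunction U φ :=
  ⟨h.1, h.2.1, hU⟩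

theorem contDiff_partialDeriv {φ : Plane → ℝ} (h : ContDiff ℝ ∞ φ) (i : Fin 2) :
    ContDiff ℝ ∞ (partialDeriv i φ) :=
  (h.fderiv_right (m := ∞) (by simp)).clm_apply contDiff_const

theorem tsupport_partialDeriv_subset (φ : Plane → ℝ) (i : Fin 2) :
    tsupport (partialDeriv i φ) ⊆ tsupport φ := by
  refine closure_minimal (fun x hx => ?_) (isClosed_tsupport φ)
  by_contra h
  apply hx
  simp [partialDeriv, fderiv_of_notMem_tsupport (𝕜 := ℝ) h]

theorem IsTestFunction.pderiv {U : Set Plane} {φ : Plane → ℝ} (h : IsTestFunction U φ)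
    (i : Fin 2) : IsTestFunction U (partialDeriv i φ) :=
  ⟨contDiff_partialDeriv h.1 i,
    h.2.1.mono' ((subset_tsupport _).trans (tsupport_partialDeriv_subset φ i)),
    (tsupport_partialDeriv_subset φ i).trans h.2.2⟩

theorem IsTestFunction.sub {U : Set Plane} {φ ψ : Plane → ℝ} (h : IsTestFunction U φ)
    (h' : IsTestFunction U ψ) : IsTestFunction U (φ - ψ) := by
  refine ⟨h.1.sub h'.1, h.2.1.sub h'.2.1, (tsupport_sub φ ψ).trans (union_subset h.2.2 h'.2.2)⟩

theorem IsTestFunction.mul_contDiff {U : Set Plane} {φ ψ : Plane → ℝ} (h : IsTestFunction U φ)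
    (h' : ContDiff ℝ ∞ ψ) : IsTestFunction U (φ * ψ) :=
  ⟨h.1.mul h', h.2.1.mul_right, (tsupport_mul_subset_left).trans h.2.2⟩

theorem IsTestFunction.continuous {U : Set Plane} {φ : Plane → ℝ} (h : IsTestFunction U φ) :
    Continuous φ := h.1.continuous

theorem IsTestFunction.memLp {U : Set Plane} {φ : Plane → ℝ} (h : IsTestFunction U φ)
    (μ : Measure Plane) [IsFiniteMeasureOnCompacts μ] : MemLp φ 2 μ :=
  h.continuous.memLp_of_hasCompactSupport h.2.1

theorem partialDeriv_mul {φ ψ : Plane → ℝ} (h : ContDiff ℝ ∞ φ) (h' : ContDiff ℝ ∞ ψ)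
    (i : Fin 2) (x : Plane) :
    partialDeriv i (φ * ψ) x = partialDeriv i φ x * ψ x + φ x * partialDeriv i ψ x := by
  simp only [partialDeriv]
  rw [fderiv_mul (h.differentiable (by simp) x) (h'.differentiable (by simp) x)]
  simp
  ring

theorem MemL2.mono {F : Type} [NormedAddCommGroup F] {U W : Set Plane} {v : Plane → F}
    (h : MemL2 U v) (hW : W ⊆ U) : MemL2 W v :=
  h.mono_measure (Measure.restrict_mono hW le_rfl)

theorem MemL2.locallyIntegrableOn {F : Type} [NormedAddCommGroup F] {U : Set Plane}
    {v : Plane → F} (h : MemL2 U v) : LocallyIntegrableOn v U :=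
  locallyIntegrableOn_of_locallyIntegrable_restrict (MemLp.locallyIntegrable h (by norm_num))

section Sobolev

variable {F : Type} [NormedAddCommGroup F] [NormedSpace ℝ F]

theorem integrable_test_smul {U U' : Set Plane} {φ : Plane → ℝ} (h : IsTestFunction U' φ)
    {v : Plane → F} (hv : MemL2 U v) : Integrable (fun x => φ x • v x) (volume.restrict U) :=
  memLp_one_iff_integrable.1 (MemLp.smul (p := 2) (q := 2) hv (h.memLp (volume.restrict U)))

theorem IsWeakPartial.congr {U : Set Plane} {i : Fin 2} {v v' w w' : Plane → F}
    (h : IsWeakPartial U i v w) (hv : v =ᵐ[volume.restrict U] v')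
    (hw : w =ᵐ[volume.restrict U] w') : IsWeakPartial U i v' w' := by
  intro φ hφ
  have h1 : ∫ x in U, partialDeriv i φ x • v x = ∫ x in U, partialDeriv i φ x • v' x :=
    integral_congr_ae (hv.mono fun x hx => by simp only [hx])
  have h2 : ∫ x in U, φ x • w x = ∫ x in U, φ x • w' x :=
    integral_congr_ae (hw.mono fun x hx => by simp only [hx])
  rw [← h1, h φ hφ, h2]

theorem IsWeakPartial.sub {U : Set Plane} {i : Fin 2} {v v' w w' : Plane → F}
    (h : IsWeakPartial U i v w) (h' : IsWeakPartial U i v' w') (hv : MemL2 U v)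
    (hv' : MemL2 U v') (hw : MemL2 U w) (hw' : MemL2 U w') :
    IsWeakPartial U i (v - v') (w - w') := by
  intro φ hφ
  simp only [Pi.sub_apply, smul_sub]
  rw [integral_sub (integrable_test_smul (hφ.pderiv i) hv)
      (integrable_test_smul (hφ.pderiv i) hv'), h φ hφ, h' φ hφ,
    integral_sub (integrable_test_smul hφ hw) (integrable_test_smul hφ hw')]
  abel

theorem IsWeakPartial.restrict {U W : Set Plane} {i : Fin 2} {v w : Plane → F}
    (h : IsWeakPartial U i v w) (hWU : W ⊆ U) : IsWeakPartial W i v w := by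
  intro φ hφ
  have key : ∀ (g : Plane → ℝ) (u : Plane → F), tsupport g ⊆ tsupport φ →
      ∫ x in W, g x • u x = ∫ x in U, g x • u x := by
    intro g u hg
    have : ∀ S : Set Plane, W ⊆ S → ∫ x in S, g x • u x = ∫ x, g x • u x := fun S hS =>
      setIntegral_eq_integral_of_forall_compl_eq_zero fun x hx => by
        rw [image_eq_zero_of_notMem_tsupport fun h1 => hx (hS (hφ.2.2 (hg h1))), zero_smul]
    rw [this W subset_rfl, this U hWU]
  have := h φ (hφ.mono hWU)
  rwa [key _ _ (tsupport_partialDeriv_subset φ i), key _ _ subset_rfl]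

theorem IsWeakPartial.ae_eq [CompleteSpace F] {U : Set Plane} (hU : IsOpen U) {i : Fin 2}
    {v w w' : Plane → F} (h : IsWeakPartial U i v w) (h' : IsWeakPartial U i v w')
    (hw : MemL2 U w) (hw' : MemL2 U w') : w =ᵐ[volume.restrict U] w' := by
  have hd : MemL2 U (w - w') := MemLp.sub hw hw'
  have := hU.ae_eq_zero_of_integral_contDiff_smul_eq_zero (μ := volume)
    hd.locallyIntegrableOn fun g hg hc hs => by
      have ht : IsTestFunction U g := ⟨hg, hc, hs⟩
      have h0 := (h g ht).symm.trans (h' g ht)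
      rw [← setIntegral_eq_integral_of_forall_compl_eq_zero (s := U) fun x hx => by
        rw [image_eq_zero_of_notMem_tsupport fun h1 => hx (hs h1), zero_smul]]
      simp only [Pi.sub_apply, smul_sub]
      rw [integral_sub (integrable_test_smul ht hw) (integrable_test_smul ht hw'),
        neg_injective h0, sub_self]
  rw [Filter.EventuallyEq, ae_restrict_iff' hU.measurableSet]
  filter_upwards [this] with x hx hxU using sub_eq_zero.1 (hx hxU)

theorem weakPartial_spec {U : Set Plane} {i : Fin 2} {v w : Plane → F} (h : IsWeakPartial U i v w)
    (hw : MemL2 U w) : MemL2 U (weakPartial U i v) ∧ IsWeakPartial U i v (weakPartial U i v) := by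
  have hex : ∃ w : Plane → F, MemL2 U w ∧ IsWeakPartial U i v w := ⟨w, hw, h⟩
  rw [weakPartial, dif_pos hex]
  exact hex.choose_spec

/-- Weak derivatives are unique by the fundamental lemma of the calculus of variations. Hence any
explicit square integrable weak derivative may replace the arbitrary choice made in `weakPartial`.
-/
theorem IsWeakPartial.weakPartial_ae_eq [CompleteSpace F] {U : Set Plane} (hU : IsOpen U)
    {i : Fin 2} {v w : Plane → F} (h : IsWeakPartial U i v w) (hw : MemL2 U w) :
    weakPartial U i v =ᵐ[volume.restrict U] w :=
  (weakPartial_spec h hw).2.ae_eq hU h (weakPartial_spec h hw).1 hw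

end Sobolev

/-- The compact support of `φ` removes all boundary terms, so `ψ` may be any smooth function. The
Poincaré inequality takes a coordinate function for `ψ`. -/
theorem integral_partialDeriv_mul {φ ψ : Plane → ℝ} (hφ : IsTestFunction univ φ)
    (hψ : ContDiff ℝ ∞ ψ) (i : Fin 2) :
    ∫ x, partialDeriv i φ x * ψ x = -∫ x, φ x * partialDeriv i ψ x := by
  have h1 : Integrable fun x => partialDeriv i φ x * ψ x :=
    ((hφ.pderiv i).mul_contDiff hψ).continuous.integrable_of_hasCompactSupport
      ((hφ.pderiv i).mul_contDiff hψ).2.1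
  have h2 : Integrable fun x => φ x * partialDeriv i ψ x :=
    (hφ.mul_contDiff (contDiff_partialDeriv hψ i)).continuous.integrable_of_hasCompactSupport
      (hφ.mul_contDiff (contDiff_partialDeriv hψ i)).2.1
  have h3 : Integrable fun x => φ x * ψ x :=
    (hφ.mul_contDiff hψ).continuous.integrable_of_hasCompactSupport (hφ.mul_contDiff hψ).2.1
  have := integral_mul_fderiv_eq_neg_fderiv_mul_of_integrable (μ := volume) (f := φ) (g := ψ)
    (v := EuclideanSpace.single i 1) h1 h2 h3
    (fun x _ => hφ.1.differentiable (by simp) x) (fun x _ => hψ.differentiable (by simp) x)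
  rw [eq_neg_iff_add_eq_zero, add_comm, ← eq_neg_iff_add_eq_zero]
  exact this

theorem isWeakPartial_of_contDiff {v : Plane → ℝ} (hv : ContDiff ℝ ∞ v) (U : Set Plane)
    (i : Fin 2) : IsWeakPartial U i v (partialDeriv i v) := by
  have : IsWeakPartial univ i v (partialDeriv i v) := fun φ hφ => by
    simpa using integral_partialDeriv_mul hφ hv i
  exact this.restrict (subset_univ U)

/-! ### H² functions with given weak derivatives -/

/-- `g` and `H` are the weak gradient and the weak Hessian of `v ∈ H²(U)`. -/
structure IsH2Data (U : Set Plane) (v : Plane → ℝ) (g : Fin 2 → Plane → ℝ)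
    (H : Fin 2 → Fin 2 → Plane → ℝ) : Prop where
  mem : MemL2 U v
  mem_grad : ∀ i, MemL2 U (g i)
  mem_hess : ∀ i j, MemL2 U (H i j)
  grad : ∀ i, IsWeakPartial U i v (g i)
  hess : ∀ i j, IsWeakPartial U j (g i) (H i j)

theorem MemH2.isH2Data {U : Set Plane} {v : Plane → ℝ} (h : MemH2 U v) :
    IsH2Data U v (fun i => weakPartial U i v) fun i j => weakPartial U j (weakPartial U i v) := by
  refine ⟨h.1.1, fun i => (h.2 i).1, fun i j => ?_, fun i => ?_, fun i j => ?_⟩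
  · obtain ⟨w, hw, hw'⟩ := (h.2 i).2 j
    exact (weakPartial_spec hw' hw).1
  · obtain ⟨w, hw, hw'⟩ := h.1.2 i
    exact (weakPartial_spec hw' hw).2
  · obtain ⟨w, hw, hw'⟩ := (h.2 i).2 j
    exact (weakPartial_spec hw' hw).2

namespace IsH2Data

variable {U : Set Plane} {v v' : Plane → ℝ} {g g' : Fin 2 → Plane → ℝ}
  {H H' : Fin 2 → Fin 2 → Plane → ℝ}

theorem weakPartial_ae_eq (hU : IsOpen U) (h : IsH2Data U v g H) (i : Fin 2) :
    weakPartial U i v =ᵐ[volume.restrict U] g i :=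
  (h.grad i).weakPartial_ae_eq hU (h.mem_grad i)

theorem hess' (hU : IsOpen U) (h : IsH2Data U v g H) (i j : Fin 2) :
    IsWeakPartial U j (weakPartial U i v) (H i j) :=
  (h.hess i j).congr (h.weakPartial_ae_eq hU i).symm (Filter.EventuallyEq.refl _ _)

theorem weakPartial_weakPartial_ae_eq (hU : IsOpen U) (h : IsH2Data U v g H) (i j : Fin 2) :
    weakPartial U j (weakPartial U i v) =ᵐ[volume.restrict U] H i j :=
  (h.hess' hU i j).weakPartial_ae_eq hU (h.mem_hess i j)

theorem lap_ae_eq (hU : IsOpen U) (h : IsH2Data U v g H) :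
    lap U v =ᵐ[volume.restrict U] fun x => ∑ i, H i i x := by
  have : ∀ᵐ x ∂volume.restrict U, ∀ i, weakPartial U i (weakPartial U i v) x = H i i x :=
    ae_all_iff.2 fun i => h.weakPartial_weakPartial_ae_eq hU i i
  filter_upwards [this] with x hx
  simp only [lap, hx]

theorem memH2 (hU : IsOpen U) (h : IsH2Data U v g H) : MemH2 U v :=
  ⟨⟨h.mem, fun i => ⟨g i, h.mem_grad i, h.grad i⟩⟩, fun i =>
    ⟨(weakPartial_spec (h.grad i) (h.mem_grad i)).1, fun j => ⟨H i j, h.mem_hess i j, h.hess' hU i j⟩⟩⟩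

theorem congr (h : IsH2Data U v g H) (hv : v =ᵐ[volume.restrict U] v') : IsH2Data U v' g H :=
  ⟨(memLp_congr_ae hv).1 h.mem, h.mem_grad, h.mem_hess,
    fun i => (h.grad i).congr hv (Filter.EventuallyEq.refl _ _), h.hess⟩

theorem sub (h : IsH2Data U v g H) (h' : IsH2Data U v' g' H') :
    IsH2Data U (v - v') (g - g') (H - H') :=
  ⟨MemLp.sub h.mem h'.mem, fun i => MemLp.sub (h.mem_grad i) (h'.mem_grad i),
    fun i j => MemLp.sub (h.mem_hess i j) (h'.mem_hess i j),
    fun i => (h.grad i).sub (h'.grad i) h.mem h'.mem (h.mem_grad i) (h'.mem_grad i),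
    fun i j => (h.hess i j).sub (h'.hess i j) (h.mem_grad i) (h'.mem_grad i) (h.mem_hess i j)
      (h'.mem_hess i j)⟩

theorem restrict {W : Set Plane} (h : IsH2Data U v g H) (hW : W ⊆ U) : IsH2Data W v g H :=
  ⟨h.mem.mono hW, fun i => (h.mem_grad i).mono hW, fun i j => (h.mem_hess i j).mono hW,
    fun i => (h.grad i).restrict hW, fun i j => (h.hess i j).restrict hW⟩

end IsH2Data

theorem memL2_of_continuous {U : Set Plane} (hU : Bornology.IsBounded U) {v : Plane → ℝ}
    (hv : Continuous v) : MemL2 U v := by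
  obtain ⟨C, hC⟩ := hU.isCompact_closure.exists_bound_of_continuousOn hv.continuousOn
  have : MemL2 (closure U) v := by
    have : IsFiniteMeasure (volume.restrict (closure U)) :=
      ⟨by simpa using hU.isCompact_closure.measure_lt_top⟩
    refine MemLp.of_bound hv.aestronglyMeasurable C ?_
    rw [ae_restrict_iff' isClosed_closure.measurableSet]
    exact Filter.Eventually.of_forall hC
  exact this.mono subset_closure

theorem isH2Data_of_contDiff {U : Set Plane} (hU : Bornology.IsBounded U) {v : Plane → ℝ}
    (hv : ContDiff ℝ ∞ v) :
    IsH2Data U v (fun i => partialDeriv i v) fun i j => partialDeriv j (partialDeriv i v) :=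
  ⟨memL2_of_continuous hU hv.continuous,
    fun i => memL2_of_continuous hU (contDiff_partialDeriv hv i).continuous,
    fun i j => memL2_of_continuous hU (contDiff_partialDeriv (contDiff_partialDeriv hv i) j).continuous,
    fun i => isWeakPartial_of_contDiff hv U i,
    fun i j => isWeakPartial_of_contDiff (contDiff_partialDeriv hv i) U j⟩

theorem MemH2.sub {U : Set Plane} (hU : IsOpen U) {v w : Plane → ℝ} (hv : MemH2 U v)
    (hw : MemH2 U w) : MemH2 U (v - w) :=
  (hv.isH2Data.sub hw.isH2Data).memH2 hU

theorem MemH2.lap_sub {U : Set Plane} (hU : IsOpen U) {v w : Plane → ℝ} (hv : MemH2 U v)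
    (hw : MemH2 U w) : lap U (v - w) =ᵐ[volume.restrict U] lap U v - lap U w := by
  filter_upwards [(hv.isH2Data.sub hw.isH2Data).lap_ae_eq hU] with x hx
  rw [hx]
  simp [lap]

theorem MemH2.memL2_lap {U : Set Plane} {v : Plane → ℝ} (hv : MemH2 U v) : MemL2 U (lap U v) :=
  memLp_finsetSum _ fun i _ => hv.isH2Data.mem_hess i i

/-! ### L₂ and H² norms -/

section L2

variable {U : Set Plane} {v w z : Plane → ℝ}

theorem l2Inner_eq_inner (hv : MemL2 U v) (hw : MemL2 U w) :
    l2Inner U v w = inner ℝ (MemLp.toLp v hv) (MemLp.toLp w hw) := by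
  rw [MeasureTheory.L2.inner_def]
  refine integral_congr_ae ?_
  filter_upwards [hv.coeFn_toLp, hw.coeFn_toLp] with x h1 h2
  simp [h1, h2, mul_comm]

theorem l2NormSq_eq_l2Inner (U : Set Plane) (v : Plane → ℝ) : l2NormSq U v = l2Inner U v v :=
  integral_congr_ae (Filter.Eventually.of_forall fun x => by simp [sq])

theorem l2NormSq_eq_norm_sq (hv : MemL2 U v) : l2NormSq U v = ‖MemLp.toLp v hv‖ ^ 2 := by
  rw [l2NormSq_eq_l2Inner, l2Inner_eq_inner hv hv, real_inner_self_eq_norm_sq]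

theorem l2NormSq_nonneg (U : Set Plane) (v : Plane → ℝ) : 0 ≤ l2NormSq U v :=
  integral_nonneg fun _ => sq_nonneg _

theorem l2NormSq_congr (h : v =ᵐ[volume.restrict U] w) : l2NormSq U v = l2NormSq U w :=
  integral_congr_ae (h.mono fun x hx => by simp only [hx])

theorem l2Inner_congr {v' w' : Plane → ℝ} (h : v =ᵐ[volume.restrict U] v')
    (h' : w =ᵐ[volume.restrict U] w') : l2Inner U v w = l2Inner U v' w' :=
  integral_congr_ae ((h.and h').mono fun x hx => by simp only [hx.1, hx.2])

theorem l2Inner_sub_left (hv : MemL2 U v) (hw : MemL2 U w) (hz : MemL2 U z) :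
    l2Inner U (v - w) z = l2Inner U v z - l2Inner U w z := by
  rw [l2Inner_eq_inner (MemLp.sub hv hw) hz, l2Inner_eq_inner hv hz, l2Inner_eq_inner hw hz,
    ← inner_sub_left, MemLp.toLp_sub hv hw]

theorem l2Inner_sq_le (hv : MemL2 U v) (hw : MemL2 U w) :
    l2Inner U v w ^ 2 ≤ l2NormSq U v * l2NormSq U w := by
  rw [l2Inner_eq_inner hv hw, l2NormSq_eq_norm_sq hv, l2NormSq_eq_norm_sq hw, ← mul_pow]
  exact sq_le_sq' (neg_le_of_abs_le (abs_real_inner_le_norm _ _)) (real_inner_le_norm _ _)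

theorem l2NormSq_add_le (hv : MemL2 U v) (hw : MemL2 U w) :
    l2NormSq U (v + w) ≤ 2 * l2NormSq U v + 2 * l2NormSq U w := by
  rw [l2NormSq_eq_norm_sq (MemLp.add hv hw), l2NormSq_eq_norm_sq hv, l2NormSq_eq_norm_sq hw,
    MemLp.toLp_add hv hw]
  have := norm_add_le (MemLp.toLp v hv) (MemLp.toLp w hw)
  nlinarith [norm_nonneg (MemLp.toLp v hv + MemLp.toLp w hw), sq_nonneg (‖MemLp.toLp v hv‖ - ‖MemLp.toLp w hw‖)]

theorem l2NormSq_sub_le (hv : MemL2 U v) (hw : MemL2 U w) :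
    l2NormSq U (v - w) ≤ 2 * l2NormSq U v + 2 * l2NormSq U w := by
  have h : l2NormSq U w = l2NormSq U (-w) := by simp [l2NormSq]
  rw [h, sub_eq_add_neg]
  exact l2NormSq_add_le hv (MemLp.neg hw)

end L2

section H2

variable {U : Set Plane} {v v' : Plane → ℝ} {g g' : Fin 2 → Plane → ℝ}
  {H H' : Fin 2 → Fin 2 → Plane → ℝ}

theorem IsH2Data.h2NormSq_eq (hU : IsOpen U) (h : IsH2Data U v g H) :
    h2NormSq U v = l2NormSq U v + ∑ i, l2NormSq U (g i) + ∑ i, ∑ j, l2NormSq U (H i j) := by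
  simp only [h2NormSq, h1NormSq, l2NormSq_congr (h.weakPartial_ae_eq hU _),
    l2NormSq_congr (h.weakPartial_weakPartial_ae_eq hU _ _)]

theorem IsH2Data.h2NormSq_sub_le (hU : IsOpen U) (h : IsH2Data U v g H)
    (h' : IsH2Data U v' g' H') :
    h2NormSq U (v - v') ≤ 2 * h2NormSq U v + 2 * h2NormSq U v' := by
  rw [(h.sub h').h2NormSq_eq hU, h.h2NormSq_eq hU, h'.h2NormSq_eq hU]
  simp only [Fin.sum_univ_two, Pi.sub_apply]
  linarith [l2NormSq_sub_le h.mem h'.mem, l2NormSq_sub_le (h.mem_grad 0) (h'.mem_grad 0),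
    l2NormSq_sub_le (h.mem_grad 1) (h'.mem_grad 1),
    l2NormSq_sub_le (h.mem_hess 0 0) (h'.mem_hess 0 0),
    l2NormSq_sub_le (h.mem_hess 0 1) (h'.mem_hess 0 1),
    l2NormSq_sub_le (h.mem_hess 1 0) (h'.mem_hess 1 0),
    l2NormSq_sub_le (h.mem_hess 1 1) (h'.mem_hess 1 1)]

theorem MemH2.l2NormSq_lap_le (h : MemH2 U v) : l2NormSq U (lap U v) ≤ 2 * h2NormSq U v := by
  have : lap U v = weakPartial U 0 (weakPartial U 0 v) + weakPartial U 1 (weakPartial U 1 v) := by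
    ext x
    simp [lap]
  rw [this]
  refine (l2NormSq_add_le (h.isH2Data.mem_hess 0 0) (h.isH2Data.mem_hess 1 1)).trans ?_
  simp only [h2NormSq, h1NormSq, Fin.sum_univ_two]
  linarith [l2NormSq_nonneg U v, l2NormSq_nonneg U (weakPartial U 0 v),
    l2NormSq_nonneg U (weakPartial U 1 v), l2NormSq_nonneg U (weakPartial U 1 (weakPartial U 0 v)),
    l2NormSq_nonneg U (weakPartial U 0 (weakPartial U 1 v))]

theorem IsTestFunction.isH2Data (h : IsTestFunction U v) :
    IsH2Data U v (fun i => partialDeriv i v)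
      fun i j => partialDeriv j (partialDeriv i v) :=
  ⟨h.memLp _, fun i => (h.pderiv i).memLp _, fun i j => ((h.pderiv i).pderiv j).memLp _,
    fun i => isWeakPartial_of_contDiff h.1 U i,
    fun i j => isWeakPartial_of_contDiff (h.pderiv i).1 U j⟩

theorem MemH2Zero.exists_test_sub (hU : IsOpen U) (hv : MemH2Zero U v) {ε : ℝ} (hε : 0 < ε) :
    ∃ φ : Plane → ℝ, IsTestFunction U φ ∧ MemH2 U (v - φ) ∧ h2NormSq U (v - φ) < ε := by
  obtain ⟨φ, hφ, h⟩ := hv.2 ε hε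
  exact ⟨φ, hφ, hv.1.sub hU (hφ.isH2Data.memH2 hU), h⟩

end H2

/-! ### The spaces V and Q -/

theorem MemV.memH2 {Ω : Set Plane} {v : Plane → ℝ} (h : MemV Ω v) : MemH2 Ω v := h.1

theorem MemV.sub {Ω : Set Plane} (hΩ : IsOpen Ω) {v w : Plane → ℝ} (hv : MemV Ω v)
    (hw : MemV Ω w) : MemV Ω (v - w) := by
  refine ⟨hv.memH2.sub hΩ hw.memH2, fun ε hε => ?_⟩
  -- The squared norm of a difference is at most twice the sum of the squared norms, hence `ε / 4`
  -- for each part.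
  obtain ⟨φ, hφ, h1, h2⟩ := MemH2Zero.exists_test_sub hΩ hv (ε := ε / 4) (by positivity)
  obtain ⟨ψ, hψ, h3, h4⟩ := MemH2Zero.exists_test_sub hΩ hw (ε := ε / 4) (by positivity)
  refine ⟨φ - ψ, hφ.sub hψ, ?_⟩
  rw [sub_sub_sub_comm]
  linarith [h1.isH2Data.h2NormSq_sub_le hΩ h3.isH2Data]

/-- The Green functional `∫_U (∇v · ∇ψ + Δv ψ)` in terms of inner products. -/
theorem green_eq_l2Inner {U : Set Plane} {v ψ : Plane → ℝ} (hv : MemH2 U v)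
    (hψ : IsTestFunction univ ψ) :
    ∫ x in U, ((∑ i, weakPartial U i v x * partialDeriv i ψ x) + lap U v x * ψ x) =
      ∑ i, l2Inner U (weakPartial U i v) (partialDeriv i ψ) + l2Inner U (lap U v) ψ := by
  have hi : ∀ i, Integrable (fun x => weakPartial U i v x * partialDeriv i ψ x)
      (volume.restrict U) := fun i => by
    simpa [mul_comm] using integrable_test_smul (hψ.pderiv i) (hv.isH2Data.mem_grad i)
  have hl : Integrable (fun x => lap U v x * ψ x) (volume.restrict U) := by
    simpa [mul_comm] using integrable_test_smul hψ hv.memL2_lap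
  rw [integral_add (integrable_finsetSum _ fun i _ => hi i) hl,
    integral_finsetSum _ fun i _ => hi i]
  rfl

theorem MemQ.sub {Ω : Set Plane} (hΩ : IsOpen Ω) {p r : Plane → ℝ} (hp : MemQ Ω p)
    (hr : MemQ Ω r) : MemQ Ω (p - r) := by
  have h := hp.1.sub hΩ hr.1
  refine ⟨h, fun φ hφ => ?_⟩
  have h1 := hp.2 φ hφ
  have h2 := hr.2 φ hφ
  rw [green_eq_l2Inner hp.1 hφ] at h1
  rw [green_eq_l2Inner hr.1 hφ] at h2
  rw [green_eq_l2Inner h hφ]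
  have e : ∀ i, l2Inner Ω (weakPartial Ω i (p - r)) (partialDeriv i φ) =
      l2Inner Ω (weakPartial Ω i p) (partialDeriv i φ) -
        l2Inner Ω (weakPartial Ω i r) (partialDeriv i φ) := fun i => by
    rw [← l2Inner_sub_left (hp.1.isH2Data.mem_grad i) (hr.1.isH2Data.mem_grad i)
      ((hφ.pderiv i).memLp _)]
    exact l2Inner_congr ((hp.1.isH2Data.sub hr.1.isH2Data).weakPartial_ae_eq hΩ i)
      (Filter.EventuallyEq.refl _ _)
  have e' : l2Inner Ω (lap Ω (p - r)) φ = l2Inner Ω (lap Ω p) φ - l2Inner Ω (lap Ω r) φ := by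
    rw [← l2Inner_sub_left hp.1.memL2_lap hr.1.memL2_lap (hφ.memLp _)]
    exact l2Inner_congr (hp.1.lap_sub hΩ hr.1) (Filter.EventuallyEq.refl _ _)
  simp only [e, e', Finset.sum_sub_distrib]
  linarith

theorem IsTestFunction.setIntegral_mul_eq {U U' : Set Plane} {φ : Plane → ℝ} (h : IsTestFunction U φ)
    (hU : U ⊆ U') (ψ : Plane → ℝ) : ∫ x in U', φ x * ψ x = ∫ x, φ x * ψ x :=
  setIntegral_eq_integral_of_forall_compl_eq_zero fun x hx => by
    rw [image_eq_zero_of_notMem_tsupport fun h1 => hx (hU (h.2.2 h1)), zero_mul]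

/-- Integration by parts turns `∫ ∂ᵢφ ∂ᵢψ` into `-∫ ∂ᵢ∂ᵢφ ψ`, which cancels the Laplacian term after
summation over `i`. -/
theorem IsTestFunction.memQ {Ω : Set Plane} (hΩ : IsOpen Ω) {φ : Plane → ℝ}
    (h : IsTestFunction Ω φ) : MemQ Ω φ := by
  have hm := h.isH2Data.memH2 hΩ
  refine ⟨hm, fun ψ hψ => ?_⟩
  rw [green_eq_l2Inner hm hψ]
  have e : ∀ i, l2Inner Ω (weakPartial Ω i φ) (partialDeriv i ψ) =
      -∫ x, partialDeriv i (partialDeriv i φ) x * ψ x := fun i => by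
    rw [integral_partialDeriv_mul ((h.mono (subset_univ _)).pderiv i) hψ.1, neg_neg,
      l2Inner_congr (h.isH2Data.weakPartial_ae_eq hΩ i) (Filter.EventuallyEq.refl _ _)]
    exact (h.pderiv i).setIntegral_mul_eq subset_rfl _
  have e' : l2Inner Ω (lap Ω φ) ψ = ∑ i, ∫ x, partialDeriv i (partialDeriv i φ) x * ψ x := by
    rw [l2Inner_congr (h.isH2Data.lap_ae_eq hΩ) (Filter.EventuallyEq.refl _ _)]
    simp only [l2Inner, Finset.sum_mul]
    rw [integral_finsetSum]
    · exact Finset.sum_congr rfl fun i _ =>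
        ((h.pderiv i).pderiv i).setIntegral_mul_eq subset_rfl _
    · intro i _
      exact integrable_test_smul ((h.pderiv i).pderiv i) (hψ.memLp _)
  rw [e', Finset.sum_congr rfl fun i _ => e i]
  simp

/-- For fixed `ψ` the Green functional is continuous in the H² norm and vanishes on test functions,
which are dense in V. -/
theorem MemV.memQ {Ω : Set Plane} (hΩ : IsOpen Ω) {v : Plane → ℝ} (hv : MemV Ω v) : MemQ Ω v := by
  refine ⟨hv.memH2, fun ψ hψ => ?_⟩
  -- The weight `2` of the last term is the constant of `MemH2.l2NormSq_lap_le`. The factor `3` in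
  -- `key` comes from (x + y + z)² ≤ 3(x² + y² + z²) and the Cauchy–Schwarz inequality.
  set K := l2NormSq Ω (partialDeriv 0 ψ) + l2NormSq Ω (partialDeriv 1 ψ) + 2 * l2NormSq Ω ψ with hK
  have hK0 : 0 ≤ K := by
    have := l2NormSq_nonneg Ω (partialDeriv 0 ψ)
    have := l2NormSq_nonneg Ω (partialDeriv 1 ψ)
    have := l2NormSq_nonneg Ω ψ
    positivity
  set T := ∫ x in Ω, ((∑ i, weakPartial Ω i v x * partialDeriv i ψ x) + lap Ω v x * ψ x) with hT
  have key : ∀ ε : ℝ, 0 < ε → T ^ 2 ≤ 3 * K * ε := by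
    intro ε hε
    obtain ⟨φ, hφ, h1, h2⟩ := MemH2Zero.exists_test_sub hΩ hv hε
    have hm := hφ.isH2Data.memH2 hΩ
    have hTφ := (hφ.memQ hΩ).2 ψ hψ
    rw [green_eq_l2Inner hm hψ] at hTφ
    rw [green_eq_l2Inner hv.memH2 hψ] at hT
    have e : ∀ i, l2Inner Ω (weakPartial Ω i (v - φ)) (partialDeriv i ψ) =
        l2Inner Ω (weakPartial Ω i v) (partialDeriv i ψ) -
          l2Inner Ω (weakPartial Ω i φ) (partialDeriv i ψ) := fun i => by
      rw [← l2Inner_sub_left (hv.memH2.isH2Data.mem_grad i) (hm.isH2Data.mem_grad i)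
        ((hψ.pderiv i).memLp _)]
      exact l2Inner_congr ((hv.memH2.isH2Data.sub hm.isH2Data).weakPartial_ae_eq hΩ i)
        (Filter.EventuallyEq.refl _ _)
    have e' : l2Inner Ω (lap Ω (v - φ)) ψ = l2Inner Ω (lap Ω v) ψ - l2Inner Ω (lap Ω φ) ψ := by
      rw [← l2Inner_sub_left hv.memH2.memL2_lap hm.memL2_lap (hψ.memLp _)]
      exact l2Inner_congr (hv.memH2.lap_sub hΩ hm) (Filter.EventuallyEq.refl _ _)
    have hT' : T = l2Inner Ω (weakPartial Ω 0 (v - φ)) (partialDeriv 0 ψ) +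
        l2Inner Ω (weakPartial Ω 1 (v - φ)) (partialDeriv 1 ψ) + l2Inner Ω (lap Ω (v - φ)) ψ := by
      rw [e, e, e', hT]
      simp only [Fin.sum_univ_two] at hTφ ⊢
      linarith
    have c0 := l2Inner_sq_le (h1.isH2Data.mem_grad 0) ((hψ.pderiv 0).memLp (volume.restrict Ω))
    have c1 := l2Inner_sq_le (h1.isH2Data.mem_grad 1) ((hψ.pderiv 1).memLp (volume.restrict Ω))
    have c2 := l2Inner_sq_le h1.memL2_lap (hψ.memLp (volume.restrict Ω))
    have hl := h1.l2NormSq_lap_le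
    have b : ∀ i, l2NormSq Ω (weakPartial Ω i (v - φ)) ≤ h2NormSq Ω (v - φ) := by
      intro i
      have hs : l2NormSq Ω (weakPartial Ω i (v - φ)) ≤ ∑ i, l2NormSq Ω (weakPartial Ω i (v - φ)) :=
        Finset.single_le_sum (f := fun i => l2NormSq Ω (weakPartial Ω i (v - φ)))
          (fun i _ => l2NormSq_nonneg _ _) (Finset.mem_univ i)
      have : 0 ≤ ∑ i, ∑ j, l2NormSq Ω (weakPartial Ω j (weakPartial Ω i (v - φ))) :=
        Finset.sum_nonneg fun i _ => Finset.sum_nonneg fun j _ => l2NormSq_nonneg _ _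
      have := l2NormSq_nonneg Ω (v - φ)
      unfold h2NormSq h1NormSq
      linarith
    have b0 := b 0
    have b1 := b 1
    have s0 : l2NormSq Ω (weakPartial Ω 0 (v - φ)) * l2NormSq Ω (partialDeriv 0 ψ) ≤
        ε * l2NormSq Ω (partialDeriv 0 ψ) :=
      mul_le_mul_of_nonneg_right (b0.trans h2.le) (l2NormSq_nonneg _ _)
    have s1 : l2NormSq Ω (weakPartial Ω 1 (v - φ)) * l2NormSq Ω (partialDeriv 1 ψ) ≤
        ε * l2NormSq Ω (partialDeriv 1 ψ) :=
      mul_le_mul_of_nonneg_right (b1.trans h2.le) (l2NormSq_nonneg _ _)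
    have s2 : l2NormSq Ω (lap Ω (v - φ)) * l2NormSq Ω ψ ≤ 2 * ε * l2NormSq Ω ψ :=
      mul_le_mul_of_nonneg_right (by linarith) (l2NormSq_nonneg _ _)
    rw [hT', hK]
    nlinarith [sq_nonneg (l2Inner Ω (weakPartial Ω 0 (v - φ)) (partialDeriv 0 ψ) -
        l2Inner Ω (weakPartial Ω 1 (v - φ)) (partialDeriv 1 ψ)),
      sq_nonneg (l2Inner Ω (weakPartial Ω 0 (v - φ)) (partialDeriv 0 ψ) - l2Inner Ω (lap Ω (v - φ)) ψ),
      sq_nonneg (l2Inner Ω (weakPartial Ω 1 (v - φ)) (partialDeriv 1 ψ) - l2Inner Ω (lap Ω (v - φ)) ψ)]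
  have h0 : T ^ 2 ≤ 0 := by
    refine le_of_forall_pos_le_add fun δ hδ => ?_
    have h3 : 0 < 3 * K + 1 := by positivity
    refine (key (δ / (3 * K + 1)) (by positivity)).trans ?_
    rw [zero_add, mul_div_assoc', div_le_iff₀ h3]
    nlinarith
  exact pow_eq_zero_iff (two_ne_zero) |>.1 (le_antisymm h0 (sq_nonneg T))

/-! ### The Poincaré inequality on V -/

/-- Since ∂₀x₀ = 1, integration by parts bounds ‖φ‖² by ‖∂₀φ‖², because |x₀| ≤ R on the support. A
second one gives ‖∇φ‖² = -(φ, Δφ). -/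
theorem IsTestFunction.poincare {Ω : Set Plane} {R : ℝ} (hR : 0 < R)
    (hΩR : ∀ x ∈ Ω, |x 0| ≤ R) {φ : Plane → ℝ} (h : IsTestFunction Ω φ) :
    ∫ x, φ x ^ 2 ≤
      16 * R ^ 4 * ∫ x, (∑ i, partialDeriv i (partialDeriv i φ) x) ^ 2 := by
  have hu : IsTestFunction univ φ := h.mono (subset_univ _)
  have int : ∀ {f g : Plane → ℝ}, IsTestFunction univ f → IsTestFunction univ g →
      Integrable fun x => f x * g x := fun hf hg =>
    (hf.mul_contDiff hg.1).continuous.integrable_of_hasCompactSupport (hf.mul_contDiff hg.1).2.1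
  set L : Plane → ℝ := fun x => ∑ i, partialDeriv i (partialDeriv i φ) x with hL
  have hLt : IsTestFunction univ L := by
    refine ⟨ContDiff.sum fun i _ => ((hu.pderiv i).pderiv i).1, ?_, subset_univ _⟩
    have : L = partialDeriv 0 (partialDeriv 0 φ) +
      partialDeriv 1 (partialDeriv 1 φ) := by ext x; simp [L]
    rw [this]
    exact ((hu.pderiv 0).pderiv 0).2.1.add ((hu.pderiv 1).pderiv 1).2.1
  have h1 : ∫ x, φ x ^ 2 = -∫ x : Plane, 2 * x 0 * φ x * partialDeriv 0 φ x := by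
    have hx : ContDiff ℝ ∞ fun x : Plane => x 0 :=
      (EuclideanSpace.proj (0 : Fin 2) : Plane →L[ℝ] ℝ).contDiff
    have := integral_partialDeriv_mul (hu.mul_contDiff hu.1) hx 0
    have hd : ∀ x, partialDeriv 0 (fun x : Plane => x 0) x = 1 := fun x => by
      have : fderiv ℝ (fun x : Plane => x 0) x = EuclideanSpace.proj (0 : Fin 2) :=
        (EuclideanSpace.proj (0 : Fin 2) : Plane →L[ℝ] ℝ).fderiv
      simp [partialDeriv, this]
    rw [eq_neg_iff_add_eq_zero, add_comm] at this
    rw [eq_neg_iff_add_eq_zero, ← this]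
    congr 1
    · exact integral_congr_ae (Filter.Eventually.of_forall fun x => by simp [hd, sq])
    · exact integral_congr_ae (Filter.Eventually.of_forall fun x => by
        simp only [partialDeriv_mul hu.1 hu.1]
        ring)
  have h2 : ∫ x, partialDeriv 0 φ x ^ 2 ≤ -∫ x, φ x * L x := by
    have e : ∀ i, ∫ x, partialDeriv i φ x ^ 2 =
        -∫ x, φ x * partialDeriv i (partialDeriv i φ) x := fun i => by
      rw [← integral_partialDeriv_mul hu (contDiff_partialDeriv hu.1 i) i]
      simp [sq]
    have : ∫ x, φ x * L x = ∑ i, ∫ x, φ x * partialDeriv i (partialDeriv i φ) x := by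
      simp only [hL, Finset.mul_sum]
      exact integral_finsetSum _ fun i _ => int hu ((hu.pderiv i).pderiv i)
    rw [this, ← Finset.sum_neg_distrib, ← Finset.sum_congr rfl fun i _ => e i, Fin.sum_univ_two]
    exact le_add_of_nonneg_right (integral_nonneg fun _ => sq_nonneg _)
  have i1 : Integrable fun x => φ x ^ 2 := by simpa [sq] using int hu hu
  have i2 : Integrable fun x => partialDeriv 0 φ x ^ 2 := by
    simpa [sq] using int (hu.pderiv 0) (hu.pderiv 0)
  have i3 : Integrable fun x => L x ^ 2 := by simpa [sq] using int hLt hLt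
  have h3 : -∫ x : Plane, 2 * x 0 * φ x * partialDeriv 0 φ x ≤
      2⁻¹ * (∫ x, φ x ^ 2) + 2 * R ^ 2 * ∫ x, partialDeriv 0 φ x ^ 2 := by
    rw [← integral_neg, ← integral_const_mul, ← integral_const_mul,
      ← integral_add (i1.const_mul _) (i2.const_mul _)]
    have i4 : Integrable fun x : Plane => 2 * x 0 * φ x * partialDeriv 0 φ x := by
      refine (int hu ((hu.pderiv 0).mul_contDiff
        (contDiff_const (c := (2 : ℝ)).mul
          (EuclideanSpace.proj (0 : Fin 2) : Plane →L[ℝ] ℝ).contDiff))).congr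
        (Filter.Eventually.of_forall fun x => ?_)
      simp only [Pi.mul_apply, PiLp.proj_apply]
      ring
    refine integral_mono i4.neg ((i1.const_mul _).add (i2.const_mul _)) fun x => ?_
    by_cases hx : x ∈ tsupport φ
    · have hxR : (x 0) ^ 2 ≤ R ^ 2 := sq_le_sq' (abs_le.1 (hΩR x (h.2.2 hx))).1
        (abs_le.1 (hΩR x (h.2.2 hx))).2
      have h5 := mul_le_mul_of_nonneg_right hxR (sq_nonneg (partialDeriv 0 φ x))
      have h6 := sq_nonneg (φ x + 2 * x 0 * partialDeriv 0 φ x)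
      simp only
      nlinarith
    · have h5 : φ x = 0 := image_eq_zero_of_notMem_tsupport hx
      have h6 : 0 ≤ 2 * R ^ 2 * partialDeriv 0 φ x ^ 2 := by positivity
      simp only [h5]
      linarith
  -- The weight `8 * R ^ 2` is chosen so that, after multiplication by 2R², the first term is a
  -- quarter of ‖φ‖². With the half from `h3`, a quarter remains on the left against 4R⁴‖Δφ‖², hence
  -- the constant 16R⁴.
  have h4 : -∫ x, φ x * L x ≤ (8 * R ^ 2)⁻¹ * (∫ x, φ x ^ 2) + 2 * R ^ 2 * ∫ x, L x ^ 2 := by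
    rw [← integral_neg, ← integral_const_mul, ← integral_const_mul,
      ← integral_add (i1.const_mul _) (i3.const_mul _)]
    refine integral_mono (int hu hLt).neg ((i1.const_mul _).add (i3.const_mul _)) fun x => ?_
    have h5 : 0 ≤ (8 * R ^ 2)⁻¹ * (φ x + 4 * R ^ 2 * L x) ^ 2 := by positivity
    have h6 : (8 * R ^ 2)⁻¹ * (φ x + 4 * R ^ 2 * L x) ^ 2 =
      (8 * R ^ 2)⁻¹ * φ x ^ 2 + 2 * R ^ 2 * L x ^ 2 + φ x * L x := by
      field_simp
      ring
    simp only
    linarith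
  have h7 : 2 * R ^ 2 * ((8 * R ^ 2)⁻¹ * ∫ x, φ x ^ 2) = 4⁻¹ * ∫ x, φ x ^ 2 := by
    field_simp
    ring
  have h8 := mul_le_mul_of_nonneg_left (h2.trans h4) (by positivity : 0 ≤ 2 * R ^ 2)
  rw [mul_add, h7] at h8
  have h9 := h1.le.trans h3
  nlinarith

theorem exists_poincare {Ω : Set Plane} (hΩ : IsOpen Ω) (hb : Bornology.IsBounded Ω) :
    ∃ C : ℝ, 0 < C ∧ ∀ v, MemV Ω v → l2NormSq Ω v ≤ C * l2NormSq Ω (lap Ω v) := by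
  obtain ⟨R, hR, hΩR⟩ := hb.exists_pos_norm_le
  have hΩR' : ∀ x ∈ Ω, |x 0| ≤ R := fun x hx => (PiLp.norm_apply_le x 0).trans (hΩR x hx)
  -- Passing from test functions to their closure costs a factor 2 for ‖v‖² and another for ‖Δφ‖²,
  -- so 16R⁴ becomes 64R⁴. The approximation error enters with the factor 2 + 128R⁴.
  refine ⟨64 * R ^ 4, by positivity, fun v hv => ?_⟩
  refine le_of_forall_pos_le_add fun δ hδ => ?_
  have h3 : 0 < 2 + 128 * R ^ 4 := by positivity
  obtain ⟨φ, hφ, h1, h2⟩ := MemH2Zero.exists_test_sub hΩ hv (ε := δ / (2 + 128 * R ^ 4)) (by positivity)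
  have hm := hφ.isH2Data.memH2 hΩ
  rw [lt_div_iff₀ h3] at h2
  have p : l2NormSq Ω φ ≤ 16 * R ^ 4 * l2NormSq Ω (lap Ω φ) := by
    have e1 : l2NormSq Ω φ = ∫ x, φ x ^ 2 := by
      simpa [l2NormSq, sq] using hφ.setIntegral_mul_eq subset_rfl φ
    have e2 : l2NormSq Ω (lap Ω φ) = ∫ x, (∑ i, partialDeriv i (partialDeriv i φ) x) ^ 2 := by
      rw [l2NormSq_congr (hφ.isH2Data.lap_ae_eq hΩ)]
      refine setIntegral_eq_integral_of_forall_compl_eq_zero fun x hx => ?_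
      have : ∀ i, partialDeriv i (partialDeriv i φ) x = 0 := fun i =>
        image_eq_zero_of_notMem_tsupport fun h1 =>
          hx (((hφ.pderiv i).pderiv i).2.2 h1)
      simp [this]
    rw [e1, e2]
    exact hφ.poincare hR hΩR'
  have a1 : l2NormSq Ω v ≤ 2 * l2NormSq Ω (v - φ) + 2 * l2NormSq Ω φ := by
    simpa using l2NormSq_add_le h1.1.1 hm.1.1
  have a2 : l2NormSq Ω (lap Ω φ) ≤ 2 * l2NormSq Ω (lap Ω v) + 2 * l2NormSq Ω (lap Ω (v - φ)) := by
    rw [← l2NormSq_congr (show lap Ω v - lap Ω (v - φ) =ᵐ[volume.restrict Ω] lap Ω φ by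
      filter_upwards [hv.memH2.lap_sub hΩ hm] with x hx
      simp [hx])]
    exact l2NormSq_sub_le hv.memH2.memL2_lap h1.memL2_lap
  have a3 : l2NormSq Ω (v - φ) ≤ h2NormSq Ω (v - φ) := by
    have : 0 ≤ ∑ i, ∑ j, l2NormSq Ω (weakPartial Ω j (weakPartial Ω i (v - φ))) :=
      Finset.sum_nonneg fun i _ => Finset.sum_nonneg fun j _ => l2NormSq_nonneg _ _
    have : 0 ≤ ∑ i, l2NormSq Ω (weakPartial Ω i (v - φ)) :=
      Finset.sum_nonneg fun i _ => l2NormSq_nonneg _ _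
    unfold h2NormSq h1NormSq
    linarith
  have a4 := h1.l2NormSq_lap_le
  have a5 := mul_le_mul_of_nonneg_left (a2.trans (add_le_add_right
    (mul_le_mul_of_nonneg_left a4 zero_le_two) _)) (by positivity : 0 ≤ 32 * R ^ 4)
  nlinarith

/-! ### Cutoffs and Gauss' formula for a half plane -/

open scoped Manifold in
/-- A test function can be multiplied by a cutoff without changing it on a closed set `C`, so that
its support moves into a neighbourhood of its support in `C`. -/
theorem exists_cutoff {φ : Plane → ℝ} (hφ : IsTestFunction univ φ) {C U : Set Plane}
    (hC : IsClosed C) (hU : IsOpen U) (h : tsupport φ ∩ C ⊆ U) :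
    ∃ ψ : Plane → ℝ, IsTestFunction univ ψ ∧ tsupport ψ ⊆ tsupport φ ∧ tsupport ψ ⊆ U ∧
      EqOn ψ φ C := by
  have hK : IsCompact (tsupport φ ∩ C) := hφ.2.1.isCompact.inter_right hC
  obtain ⟨K', hK', h1, h2⟩ := exists_compact_between hK hU h
  obtain ⟨χ, hχ1, hχ0, -⟩ := exists_contMDiffMap_one_nhds_of_subset_interior (n := (⊤ : ℕ∞))
    𝓘(ℝ, Plane) hK.isClosed h1
  have hχ : ContDiff ℝ ∞ (χ : Plane → ℝ) := χ.contMDiff.contDiff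
  refine ⟨φ * χ, hφ.mul_contDiff hχ, tsupport_mul_subset_left, ?_, fun x hx => ?_⟩
  · refine tsupport_mul_subset_right.trans ((closure_minimal (fun x hx => ?_) hK'.isClosed).trans h2)
    by_contra h3
    exact hx (hχ0 x h3)
  · by_cases hxs : x ∈ tsupport φ
    · have : χ x = 1 := hχ1.self_of_nhdsSet x ⟨hxs, hx⟩
      simp [this]
    · simp [image_eq_zero_of_notMem_tsupport hxs]

theorem partialDeriv_eq_of_eqOn {φ ψ : Plane → ℝ} {W : Set Plane} (hW : IsOpen W)
    (h : EqOn φ ψ W) (i : Fin 2) : EqOn (partialDeriv i φ) (partialDeriv i ψ) W := fun x hx => by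
  have : φ =ᶠ[nhds x] ψ := Filter.eventually_of_mem (hW.mem_nhds hx) h
  simp only [partialDeriv, this.fderiv_eq]

/-- The rotation of a vector by a right angle. -/
def rot (n : Plane) : Plane := !₂[-n 1, n 0]

theorem inner_plane (x y : Plane) : inner ℝ x y = x 0 * y 0 + x 1 * y 1 := by
  simp [PiLp.inner_apply, Fin.sum_univ_two, mul_comm]

theorem norm_sq_plane (x : Plane) : ‖x‖ ^ 2 = x 0 ^ 2 + x 1 ^ 2 := by
  rw [← real_inner_self_eq_norm_sq, inner_plane]
  ring

/-- The orthonormal frame `(rot n, n)` at the point `a`. -/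
def frame (a n : Plane) (p : ℝ × ℝ) : Plane := a + (p.1 • rot n + p.2 • n)

section Frame

variable {a n : Plane} (hn : ‖n‖ = 1)
include hn

theorem unit_sq : n 0 ^ 2 + n 1 ^ 2 = 1 := by rw [← norm_sq_plane, hn, one_pow]

/-- The vectors `rot n` and `n` are orthonormal, so `frame a n` is a linear isometry followed by a
translation. Area integrals can then be iterated in the tangential and the normal variable. -/
theorem frame_measurePreserving : MeasurePreserving (frame a n) ∧ MeasurableEmbedding (frame a n) := by
  let L : Plane →ₗᵢ[ℝ] Plane :=
    { toFun := fun x => x 0 • rot n + x 1 • n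
      map_add' := fun x y => by simp only [PiLp.add_apply]; module
      map_smul' := fun c x => by simp only [PiLp.smul_apply, smul_eq_mul, RingHom.id_apply]; module
      norm_map' := fun x => by
        rw [← sq_eq_sq₀ (norm_nonneg _) (norm_nonneg _), norm_sq_plane, norm_sq_plane]
        have := unit_sq hn
        simp [rot]
        linear_combination (x 0 ^ 2 + x 1 ^ 2) * this }
  let E : Plane ≃ₗᵢ[ℝ] Plane := L.toLinearIsometryEquiv rfl
  have h1 := (volume_preserving_finTwoArrow ℝ).symm
  have h2 : MeasurePreserving (fun p : ℝ × ℝ => (WithLp.toLp 2 (MeasurableEquiv.finTwoArrow.symm p) : Plane)) :=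
    (PiLp.volume_preserving_toLp (Fin 2)).comp h1
  have h3 := (measurePreserving_add_left (volume : Measure Plane) a).comp (E.measurePreserving.comp h2)
  have he : frame a n = (fun x => a + x) ∘ E ∘
      (fun p : ℝ × ℝ => (WithLp.toLp 2 (MeasurableEquiv.finTwoArrow.symm p) : Plane)) := by
    ext1 p
    simp [frame, E, L, MeasurableEquiv.finTwoArrow]
  rw [he]
  refine ⟨h3, (measurableEmbedding_addLeft a).comp (E.toHomeomorph.measurableEmbedding.comp ?_)⟩
  exact (MeasurableEquiv.toLp 2 (Fin 2 → ℝ)).measurableEmbedding.comp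
    (MeasurableEquiv.finTwoArrow.symm.measurableEmbedding)

theorem inner_frame (p : ℝ × ℝ) : inner ℝ n (frame a n p - a) = p.2 := by
  have := unit_sq hn
  simp [frame, inner_plane, rot]
  linear_combination p.2 * this

theorem frame_surjective : Function.Surjective (frame a n) := by
  intro y
  have := unit_sq hn
  refine ⟨(inner ℝ (rot n) (y - a), inner ℝ n (y - a)), ?_⟩
  simp only [frame, inner_plane, rot]
  ext i
  fin_cases i
  · simp
    linear_combination (y 0 - a 0) * this
  · simp
    linear_combination (y 1 - a 1) * this

theorem range_frame : range (fun t => frame a n (t, 0)) = {y | inner ℝ n (y - a) = 0} := by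
  ext y
  constructor
  · rintro ⟨t, rfl⟩
    exact inner_frame hn (t, 0)
  · intro hy
    obtain ⟨p, rfl⟩ := frame_surjective (a := a) hn y
    rw [mem_ofPred_eq, inner_frame hn] at hy
    exact ⟨p.1, by rw [← hy]⟩

theorem isometry_frame : Isometry fun t => frame a n (t, 0) := by
  refine Isometry.of_dist_eq fun s t => ?_
  have h : frame a n (s, 0) - frame a n (t, 0) = (s - t) • rot n := by
    simp only [frame]
    module
  have h' : ‖rot n‖ = 1 := by
    rw [← sq_eq_sq₀ (norm_nonneg _) zero_le_one, norm_sq_plane]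
    have := unit_sq hn
    simp [rot]
    linarith
  rw [dist_eq_norm, h, norm_smul, h', mul_one, Real.dist_eq, Real.norm_eq_abs]

theorem integral_line (f : Plane → ℝ) :
    ∫ t, f (frame a n (t, 0)) =
      ∫ y, f y ∂((Measure.hausdorffMeasure 1).restrict {y | inner ℝ n (y - a) = 0}) := by
  have hi := isometry_frame (a := a) hn
  rw [← range_frame hn, ← hi.map_hausdorffMeasure (Or.inl zero_le_one), hausdorffMeasure_real,
    hi.isClosedEmbedding.measurableEmbedding.integral_map]

theorem setIntegral_halfPlane (f : Plane → ℝ) :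
    ∫ y in {y | inner ℝ n (y - a) ≤ 0}, f y =
      ∫ p in (univ : Set ℝ) ×ˢ Iic (0 : ℝ), f (frame a n p) := by
  obtain ⟨h1, h2⟩ := frame_measurePreserving (a := a) hn
  rw [← h1.setIntegral_preimage_emb h2]
  congr 2
  ext p
  simp [inner_frame hn]

/-- Gauss' formula for a half plane. -/
theorem integral_partialDeriv_halfPlane {ψ : Plane → ℝ} (hψ : IsTestFunction univ ψ) (i : Fin 2) :
    ∫ y in {y | inner ℝ n (y - a) ≤ 0}, partialDeriv i ψ y =
      n i * ∫ y, ψ y ∂((Measure.hausdorffMeasure 1).restrict {y | inner ℝ n (y - a) = 0}) := by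
  have hfr : Continuous (frame a n) := by unfold frame; fun_prop
  have hemb : Topology.IsClosedEmbedding (frame a n) := by
    have hinv : Continuous fun y : Plane => ((inner ℝ (rot n) (y - a), inner ℝ n (y - a)) : ℝ × ℝ) := by
      fun_prop
    have hl : Function.LeftInverse
        (fun y : Plane => ((inner ℝ (rot n) (y - a), inner ℝ n (y - a)) : ℝ × ℝ)) (frame a n) := by
      intro p
      refine Prod.ext ?_ (inner_frame hn p)
      have := unit_sq hn
      simp [frame, inner_plane, rot]
      linear_combination p.1 * this
    exact hl.isClosedEmbedding hinv hfr
  have hcs : ∀ v : Plane, HasCompactSupport fun p : ℝ × ℝ => fderiv ℝ ψ (frame a n p) v := fun v =>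
    (HasCompactSupport.fderiv_apply (𝕜 := ℝ) hψ.2.1 v).comp_isClosedEmbedding hemb
  have hct : ∀ v : Plane, Continuous fun p : ℝ × ℝ => fderiv ℝ ψ (frame a n p) v := fun v =>
    (((hψ.1.continuous_fderiv (by simp)).comp hfr).clm_apply continuous_const)
  have hint : ∀ v : Plane, Integrable fun p : ℝ × ℝ => fderiv ℝ ψ (frame a n p) v := fun v =>
    (hct v).integrable_of_hasCompactSupport (hcs v)
  have hd1 : ∀ s t : ℝ, HasDerivAt (fun s => ψ (frame a n (s, t)))
      (fderiv ℝ ψ (frame a n (s, t)) (rot n)) s := fun s t => by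
    refine HasFDerivAt.comp_hasDerivAt s
      (hψ.1.differentiable (by simp) (frame a n (s, t))).hasFDerivAt ?_
    have := (((hasDerivAt_id s).smul_const (rot n)).add_const (t • n)).const_add a
    simpa [frame] using this
  have hd2 : ∀ s t : ℝ, HasDerivAt (fun t => ψ (frame a n (s, t)))
      (fderiv ℝ ψ (frame a n (s, t)) n) t := fun s t => by
    refine HasFDerivAt.comp_hasDerivAt t
      (hψ.1.differentiable (by simp) (frame a n (s, t))).hasFDerivAt ?_
    have := (((hasDerivAt_id t).smul_const n).const_add (s • rot n)).const_add a
    simpa [frame] using this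
  have hc1 : ∀ t : ℝ, HasCompactSupport fun s => ψ (frame a n (s, t)) := fun t =>
    (hψ.2.1.comp_isClosedEmbedding hemb).comp_isClosedEmbedding
      (Topology.IsClosedEmbedding.of_continuous_injective_isClosedMap (by fun_prop)
        (fun s s' h => (Prod.ext_iff.1 h).1) (isClosedMap_prodMk_right t))
  have hc2 : ∀ s : ℝ, HasCompactSupport fun t => ψ (frame a n (s, t)) := fun s =>
    (hψ.2.1.comp_isClosedEmbedding hemb).comp_isClosedEmbedding
      (Topology.IsClosedEmbedding.of_continuous_injective_isClosedMap (by fun_prop)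
        (fun s s' h => (Prod.ext_iff.1 h).2) (isClosedMap_prodMk_left s))
  have hC1 : ∀ t : ℝ, ContDiff ℝ 1 fun s => ψ (frame a n (s, t)) := fun t =>
    (hψ.1.of_le (by simp)).comp (by unfold frame; fun_prop)
  have hC2 : ∀ s : ℝ, ContDiff ℝ 1 fun t => ψ (frame a n (s, t)) := fun s =>
    (hψ.1.of_le (by simp)).comp (by unfold frame; fun_prop)
  -- The tangential derivative integrates to 0 along every line parallel to the boundary.
  have I1 : ∫ p in (univ : Set ℝ) ×ˢ Iic (0 : ℝ), fderiv ℝ ψ (frame a n p) (rot n) = 0 := by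
    have e := (hint (rot n)).integrableOn (s := (univ : Set ℝ) ×ˢ Iic (0 : ℝ))
    rw [Measure.volume_eq_prod] at e ⊢
    rw [IntegrableOn, ← Measure.prod_restrict] at e
    rw [← Measure.prod_restrict, integral_prod_symm _ e]
    refine integral_eq_zero_of_ae (Filter.Eventually.of_forall fun t => ?_)
    rw [Measure.restrict_univ]
    have := integral_of_hasDerivAt_of_tendsto (fun s => hd1 s t)
      (by
        have h : (fun s => fderiv ℝ ψ (frame a n (s, t)) (rot n)) =
          deriv fun s => ψ (frame a n (s, t)) := funext fun s => (hd1 s t).deriv.symm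
        rw [h]
        exact ((hC1 t).continuous_deriv le_rfl).integrable_of_hasCompactSupport (hc1 t).deriv)
      ((hc1 t).is_zero_at_infty.mono_left atBot_le_cocompact)
      ((hc1 t).is_zero_at_infty.mono_left atTop_le_cocompact)
    simpa using this
  -- The normal derivative integrates, along every normal line, to the value on the boundary line.
  have I2 : ∫ p in (univ : Set ℝ) ×ˢ Iic (0 : ℝ), fderiv ℝ ψ (frame a n p) n =
      ∫ s, ψ (frame a n (s, 0)) := by
    have e := (hint n).integrableOn (s := (univ : Set ℝ) ×ˢ Iic (0 : ℝ))
    rw [Measure.volume_eq_prod] at e ⊢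
    rw [setIntegral_prod _ e, Measure.restrict_univ]
    refine integral_congr_ae (Filter.Eventually.of_forall fun s => ?_)
    have h := HasCompactSupport.integral_Iic_deriv_eq (hC2 s) (hc2 s) 0
    simpa [(hd2 s _).deriv] using h
  -- The coordinate vector is expanded in the orthonormal frame. Only its normal part survives
  -- integration, which produces the factor `n i`.
  have hdec : ∀ y, partialDeriv i ψ y = rot n i * fderiv ℝ ψ y (rot n) + n i * fderiv ℝ ψ y n := by
    intro y
    have : EuclideanSpace.single i (1 : ℝ) = rot n i • rot n + n i • n := by
      have hu := unit_sq hn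
      ext j
      fin_cases i <;> fin_cases j <;> simp [rot] <;> linarith
    rw [partialDeriv, this]
    simp
  rw [setIntegral_halfPlane hn]
  simp only [hdec]
  rw [integral_add ((hint _).integrableOn.const_mul _) ((hint _).integrableOn.const_mul _),
    integral_const_mul, integral_const_mul, I1, I2, integral_line hn]
  ring

end Frame

/-! ### Convex geometry of triangles and their edges -/

theorem affineSpan_ne_top_of_card_le {t : Finset Plane} (ht : t.card ≤ 2) :
    affineSpan ℝ (t : Set Plane) ≠ ⊤ := by
  intro h
  rcases t.eq_empty_or_nonempty with rfl | hne
  · simp at h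
  · have : Nonempty t := hne.to_subtype
    have h1 := finrank_vectorSpan_range_add_one_le ℝ ((↑) : t → Plane)
    have h2 : vectorSpan ℝ (range ((↑) : t → Plane)) = ⊤ := by
      rw [← direction_affineSpan, Subtype.range_coe_subtype]
      change (affineSpan ℝ (t : Set Plane)).direction = ⊤
      rw [h, AffineSubspace.direction_top]
    rw [h2, finrank_top] at h1
    simp at h1
    omega

theorem volume_convexHull_of_card_le {t : Finset Plane} (ht : t.card ≤ 2) :
    volume (convexHull ℝ (t : Set Plane)) = 0 :=
  measure_mono_null (convexHull_subset_affineSpan _)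
    (Measure.addHaar_affineSubspace _ _ (affineSpan_ne_top_of_card_le ht))

theorem interior_convexHull_of_card_le {t : Finset Plane} (ht : t.card ≤ 2) :
    interior (convexHull ℝ (t : Set Plane)) = ∅ := by
  by_contra h
  have h1 := isOpen_interior.measure_pos volume (nonempty_iff_ne_empty.2 h)
  exact h1.ne' (measure_mono_null interior_subset (volume_convexHull_of_card_le ht))

theorem isClosed_hull (s : Finset Plane) : IsClosed (convexHull ℝ (s : Set Plane)) :=
  s.finite_toSet.isClosed_convexHull ℝ

theorem isOpen_cell (s : Finset Plane) : IsOpen (cell s) := isOpen_interior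

theorem isBounded_cell (s : Finset Plane) : Bornology.IsBounded (cell s) :=
  (s.finite_toSet.isCompact_convexHull ℝ).isBounded.subset interior_subset

theorem cell_ae_eq_hull (s : Finset Plane) :
    cell s =ᵐ[volume] convexHull ℝ (s : Set Plane) := by
  refine (LE.le.eventuallyLE interior_subset).antisymm ?_
  rw [ae_le_set]
  refine measure_mono_null (fun x hx => ?_) ((convex_convexHull ℝ (s : Set Plane)).addHaar_frontier volume)
  exact ⟨subset_closure hx.1, hx.2⟩

open Classical in
-- The vertices form an affine basis, and the coordinates, indexed by all points and set to 0 off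
-- `s`, describe the closed and the open triangle by linear inequalities.
theorem exists_barycentric {s : Finset Plane} (hs : s.card = 3)
    (hi : AffineIndependent ℝ ((↑) : s → Plane)) :
    ∃ l : Plane → Plane →ᵃ[ℝ] ℝ, (∀ v, Continuous (l v)) ∧
      (∀ v ∈ s, ∀ w ∈ s, l v w = if v = w then 1 else 0) ∧ (∀ x, ∑ v ∈ s, l v x = 1) ∧
      (∀ x, ∑ v ∈ s, l v x • v = x) ∧
      convexHull ℝ (s : Set Plane) = {x | ∀ v ∈ s, 0 ≤ l v x} ∧
      cell s = {x | ∀ v ∈ s, 0 < l v x} := by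
  have htop : affineSpan ℝ (range ((↑) : s → Plane)) = ⊤ := by
    rw [hi.affineSpan_eq_top_iff_card_eq_finrank_add_one]
    simp [hs]
  let B : AffineBasis s ℝ Plane := ⟨(↑), hi, htop⟩
  have hB : ∀ i, B i = i := fun i => rfl
  have hr : range B = s := Subtype.range_coe
  let l : Plane → Plane →ᵃ[ℝ] ℝ := fun v => if h : v ∈ s then B.coord ⟨v, h⟩ else 0
  have hl : ∀ i : s, l i = B.coord i := fun i => by simp [l]
  have hsum : ∀ {M : Type} [AddCommMonoid M] (f : Plane → M), ∑ v ∈ s, f v = ∑ i : s, f i :=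
    fun f => (Finset.sum_coe_sort s f).symm
  refine ⟨l, fun v => ?_, fun v hv w hw => ?_, fun x => ?_, fun x => ?_, ?_, ?_⟩
  · by_cases h : v ∈ s
    · simp only [l, dif_pos h]
      exact continuous_barycentric_coord B _
    · simp only [l, dif_neg h]
      exact continuous_const
  · have := B.coord_apply ⟨v, hv⟩ ⟨w, hw⟩
    rw [hl ⟨v, hv⟩]
    simpa [hB] using this
  · rw [hsum]
    simp only [hl]
    exact B.sum_coord_apply_eq_one x
  · rw [hsum]
    simp only [hl]
    exact B.linear_combination_coord_eq_self x
  · rw [← hr, B.convexHull_eq_nonneg_coord]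
    ext x
    exact ⟨fun h v hv => by rw [hl ⟨v, hv⟩]; exact h _, fun h i => by rw [← hl i]; exact h i i.2⟩
  · rw [cell, ← hr, B.interior_convexHull]
    ext x
    exact ⟨fun h v hv => by rw [hl ⟨v, hv⟩]; exact h _, fun h i => by rw [← hl i]; exact h i i.2⟩

open Classical in
theorem mem_convexHull_erase {s : Finset Plane} {l : Plane → Plane →ᵃ[ℝ] ℝ}
    (h1 : ∀ x, ∑ v ∈ s, l v x = 1) (h2 : ∀ x, ∑ v ∈ s, l v x • v = x) {x b : Plane}
    (h0 : ∀ v ∈ s, 0 ≤ l v x) (hb : b ∈ s) (hbx : l b x = 0) :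
    x ∈ convexHull ℝ ((s.erase b : Finset Plane) : Set Plane) := by
  rw [Finset.mem_convexHull']
  refine ⟨fun v => l v x, fun v hv => h0 v (Finset.mem_of_mem_erase hv), ?_, ?_⟩
  · rw [← h1 x, ← Finset.add_sum_erase s _ hb, hbx, zero_add]
  · conv_rhs => rw [← h2 x, ← Finset.add_sum_erase s _ hb, hbx, zero_smul, zero_add]

/-- `e` is an edge of the nondegenerate triangle `s`. -/
structure IsTriangleEdge (s e : Finset Plane) : Prop where
  card : s.card = 3
  indep : AffineIndependent ℝ ((↑) : s → Plane)
  subset : e ⊆ s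
  card_edge : e.card = 2

theorem inner_eq_zero_of_mem_edge {s e : Finset Plane} {n : Plane} (hn : IsOutwardNormal s e n) {a : Plane} (ha : a ∈ e)
    {y : Plane} (hy : y ∈ edge e) : inner ℝ n (y - a) = 0 := by
  obtain ⟨w, -, hw1, hw⟩ := Finset.mem_convexHull'.1 hy
  have : y - a = ∑ v ∈ e, w v • (v - a) := by
    simp only [smul_sub, Finset.sum_sub_distrib, ← Finset.sum_smul, hw1, hw, one_smul]
  rw [this, inner_sum]
  exact Finset.sum_eq_zero fun v hv => by rw [real_inner_smul_right, hn.2.1 v hv a ha, mul_zero]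

theorem edge_subset_hull {s e : Finset Plane} (hes : e ⊆ s) : edge e ⊆ convexHull ℝ (s : Set Plane) :=
  convexHull_mono (by exact_mod_cast hes)

namespace IsTriangleEdge

variable {s e : Finset Plane} (h : IsTriangleEdge s e)
include h

open Classical in
theorem exists_opposite : ∃ c ∈ s, c ∉ e ∧ e = s.erase c := by
  have h1 : (s \ e).card = 1 := by
    rw [Finset.card_sdiff_of_subset h.subset, h.card, h.card_edge]
  obtain ⟨c, hc⟩ := Finset.card_eq_one.1 h1
  have hc' : c ∈ s \ e := by simp [hc]
  rw [Finset.mem_sdiff] at hc'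
  refine ⟨c, hc'.1, hc'.2, ?_⟩
  rw [Finset.erase_eq, ← hc, Finset.sdiff_sdiff_eq_self h.subset]

theorem exists_vertices : ∃ a b, a ≠ b ∧ e = {a, b} := Finset.card_eq_two.1 h.card_edge

/-- The barycentric coordinate of the opposite vertex vanishes on `e` and is 1 at that vertex. Its
gradient, normalised and with reversed sign, is the outward normal. -/
theorem isOutwardNormal : IsOutwardNormal s e (outwardNormal s e) := by
  classical
  have hex : ∃ n, IsOutwardNormal s e n := by
    obtain ⟨l, -, hl, -, -, -, -⟩ := exists_barycentric h.card h.indep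
    obtain ⟨c, hc, hce, he⟩ := h.exists_opposite
    obtain ⟨a, b, hab, hab'⟩ := h.exists_vertices
    have ha : a ∈ e := by simp [hab']
    let r : Plane := (InnerProductSpace.toDual ℝ Plane).symm (l c).linear.toContinuousLinearMap
    have hr : ∀ x y, inner ℝ r (x - y) = l c x - l c y := fun x y => by
      rw [InnerProductSpace.toDual_symm_apply]
      exact (l c).linearMap_vsub x y
    have h0 : ∀ x ∈ e, l c x = 0 := fun x hx => by
      rw [hl c hc x (h.subset hx), if_neg]
      rintro rfl
      exact hce hx
    have h1 : l c c = 1 := by rw [hl c hc c hc, if_pos rfl]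
    have hr0 : r ≠ 0 := by
      intro h2
      have := hr c a
      rw [h2, inner_zero_left, h1, h0 a ha] at this
      norm_num at this
    have hpos : 0 < ‖r‖⁻¹ := inv_pos.2 (norm_pos_iff.2 hr0)
    refine ⟨-(‖r‖⁻¹ • r), ?_, fun x hx y hy => ?_, fun z hz hze x hx => ?_⟩
    · rw [norm_neg, norm_smul, norm_inv, norm_norm, inv_mul_cancel₀ (norm_ne_zero_iff.2 hr0)]
    · rw [inner_neg_left, real_inner_smul_left, hr, h0 x hx, h0 y hy]
      simp
    · have : z = c := by
        by_contra h2
        exact hze (he ▸ Finset.mem_erase.2 ⟨h2, hz⟩)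
      rw [inner_neg_left, real_inner_smul_left, hr, this, h1, h0 x hx]
      simpa using hpos
  rw [outwardNormal, dif_pos hex]
  exact hex.choose_spec

open Classical in
-- The signed distance from the line through `e` is a negative multiple of the barycentric
-- coordinate of the opposite vertex. This translates inequalities between coordinates into half
-- plane conditions.
theorem inner_normal_eq {n : Plane} (hn : IsOutwardNormal s e n) {a : Plane} (ha : a ∈ e) :
    ∃ c ∈ s, c ∉ e ∧ e = s.erase c ∧ inner ℝ n (c - a) < 0 ∧
      ∀ l : Plane → Plane →ᵃ[ℝ] ℝ, (∀ x, ∑ v ∈ s, l v x = 1) → (∀ x, ∑ v ∈ s, l v x • v = x) →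
        ∀ y, inner ℝ n (y - a) = l c y * inner ℝ n (c - a) := by
  obtain ⟨c, hc, hce, he⟩ := h.exists_opposite
  refine ⟨c, hc, hce, he, hn.2.2 c hc hce a ha, fun l h1 h2 y => ?_⟩
  have : y - a = ∑ v ∈ s, l v y • (v - a) := by
    simp only [smul_sub, Finset.sum_sub_distrib, ← Finset.sum_smul, h1, h2, one_smul]
  rw [this, inner_sum, Finset.sum_eq_single_of_mem c hc, real_inner_smul_right]
  intro v hv hvc
  rw [real_inner_smul_right, hn.2.1 v (he ▸ Finset.mem_erase.2 ⟨hvc, hv⟩) a ha, mul_zero]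

theorem inner_nonpos {n : Plane} (hn : IsOutwardNormal s e n) {a : Plane} (ha : a ∈ e) {y : Plane}
    (hy : y ∈ convexHull ℝ (s : Set Plane)) : inner ℝ n (y - a) ≤ 0 := by
  classical
  obtain ⟨l, -, -, h1, h2, h3, -⟩ := exists_barycentric h.card h.indep
  obtain ⟨c, hc, -, -, hneg, hin⟩ := h.inner_normal_eq hn ha
  rw [h3] at hy
  rw [hin l h1 h2]
  exact mul_nonpos_of_nonneg_of_nonpos (hy c hc) hneg.le

theorem mem_edge_of_inner_eq_zero {n : Plane} (hn : IsOutwardNormal s e n) {a : Plane} (ha : a ∈ e)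
    {y : Plane} (hy : y ∈ convexHull ℝ (s : Set Plane)) (hy0 : inner ℝ n (y - a) = 0) :
    y ∈ edge e := by
  classical
  obtain ⟨l, -, -, h1, h2, h3, -⟩ := exists_barycentric h.card h.indep
  obtain ⟨c, hc, -, he, hneg, hin⟩ := h.inner_normal_eq hn ha
  rw [h3] at hy
  rw [hin l h1 h2] at hy0
  rw [edge, he]
  exact mem_convexHull_erase h1 h2 hy hc ((mul_eq_zero.1 hy0).resolve_right hneg.ne)

/-- Near a point of the triangle off the other two edges, the triangle is a half plane. -/
theorem eventually_mem_hull {n : Plane} (hn : IsOutwardNormal s e n) {a : Plane} (ha : a ∈ e)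
    {x : Plane} (hx : x ∈ convexHull ℝ (s : Set Plane))
    (hxe : ∀ e' ⊆ s, e'.card = 2 → e' ≠ e → x ∉ edge e') :
    ∀ᶠ y in nhds x, inner ℝ n (y - a) ≤ 0 → y ∈ convexHull ℝ (s : Set Plane) := by
  classical
  obtain ⟨l, hl, -, h1, h2, h3, -⟩ := exists_barycentric h.card h.indep
  obtain ⟨c, hc, hce, he, hneg, hin⟩ := h.inner_normal_eq hn ha
  rw [h3] at hx ⊢
  -- If the coordinate of a vertex of `e` vanished, `x` would lie on the edge opposite to that
  -- vertex, which is not `e`.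
  have hpos : ∀ v ∈ e, 0 < l v x := fun v hv => by
    refine lt_of_le_of_ne (hx v (h.subset hv)) fun h0 => ?_
    refine hxe (s.erase v) (Finset.erase_subset _ _)
      (by rw [Finset.card_erase_of_mem (h.subset hv), h.card]) ?_
      (mem_convexHull_erase h1 h2 hx (h.subset hv) h0.symm)
    intro h4
    rw [← h4] at hv
    simp at hv
  have hev : ∀ᶠ y in nhds x, ∀ v ∈ e, 0 < l v y :=
    (Filter.eventually_all_finset e).2 fun v hv =>
      continuousAt_const.eventually_lt (hl v).continuousAt (hpos v hv)
  filter_upwards [hev] with y hy hle v hv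
  -- The coordinates belonging to `e` stay positive near `x`. The remaining one is nonnegative
  -- exactly on the half plane.
  by_cases hvc : v = c
  · rw [hin l h1 h2] at hle
    rw [hvc]
    by_contra h5
    exact hle.not_gt (mul_pos_of_neg_of_neg (not_le.1 h5) hneg)
  · exact (hy v (he ▸ Finset.mem_erase.2 ⟨hvc, hv⟩)).le

end IsTriangleEdge

/-! ### Unit normals and Gauss' formula for a triangle -/

/-- Two unit vectors orthogonal to a given direction of the plane agree up to sign. -/
theorem eq_or_eq_neg_of_unit_orthogonal {m n d : Plane} (hm : ‖m‖ = 1) (hn : ‖n‖ = 1) (hd : d ≠ 0)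
    (hmd : inner ℝ m d = 0) (hnd : inner ℝ n d = 0) : m = n ∨ m = -n := by
  have h1 := norm_sq_plane m
  have h2 := norm_sq_plane n
  rw [hm] at h1
  rw [hn] at h2
  rw [inner_plane] at hmd hnd
  have hd2 : d 0 ^ 2 + d 1 ^ 2 ≠ 0 := by
    rw [← norm_sq_plane]
    exact pow_ne_zero 2 (norm_ne_zero_iff.2 hd)
  have hdet : m 0 * n 1 - m 1 * n 0 = 0 := by
    have h3 : (d 0 ^ 2 + d 1 ^ 2) * (m 0 * n 1 - m 1 * n 0) = 0 := by
      linear_combination (d 0 * n 1 - d 1 * n 0) * hmd + (d 1 * m 0 - d 0 * m 1) * hnd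
    exact (mul_eq_zero.1 h3).resolve_left hd2
  -- Lagrange's identity: the squares of the inner product and of the determinant add up to 1, and
  -- the determinant is 0.
  have hdot : (m 0 * n 0 + m 1 * n 1 - 1) * (m 0 * n 0 + m 1 * n 1 + 1) = 0 := by
    linear_combination (-(m 0 * n 1 - m 1 * n 0)) * hdet - h1 * (n 0 ^ 2 + n 1 ^ 2) - h2
  rcases mul_eq_zero.1 hdot with h3 | h3
  · left
    rw [← sub_eq_zero, ← norm_eq_zero, ← sq_eq_zero_iff, norm_sq_plane]
    simp only [PiLp.sub_apply]
    linear_combination -h1 - h2 - 2 * h3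
  · right
    rw [← add_eq_zero_iff_eq_neg, ← norm_eq_zero, ← sq_eq_zero_iff, norm_sq_plane]
    simp only [PiLp.add_apply]
    linear_combination -h1 - h2 + 2 * h3

/-- `φ` vanishes near the edges of the triangle `s` other than `e`. -/
def IsAdmissible (s e : Finset Plane) (φ : Plane → ℝ) : Prop :=
  IsTestFunction univ φ ∧ ∀ e' ⊆ s, e'.card = 2 → e' ≠ e → Disjoint (tsupport φ) (edge e')

theorem IsAdmissible.mul_contDiff {s e : Finset Plane} {φ ψ : Plane → ℝ} (h : IsAdmissible s e φ)
    (hψ : ContDiff ℝ ∞ ψ) : IsAdmissible s e (φ * ψ) :=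
  ⟨h.1.mul_contDiff hψ, fun e' h1 h2 h3 => (h.2 e' h1 h2 h3).mono_left tsupport_mul_subset_left⟩

/-- Gauss' formula for a triangle. -/
theorem IsTriangleEdge.integral_partialDeriv {s e : Finset Plane} (h : IsTriangleEdge s e)
    {φ : Plane → ℝ} (hφ : IsAdmissible s e φ) (i : Fin 2) :
    ∫ x in cell s, partialDeriv i φ x = outwardNormal s e i * ∫ x, φ x ∂(arc e) := by
  have hn := h.isOutwardNormal
  set n := outwardNormal s e
  obtain ⟨a, b, -, hab⟩ := h.exists_vertices
  have ha : a ∈ e := by simp [hab]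
  set Hp : Set Plane := {y | inner ℝ n (y - a) ≤ 0} with hHp
  set U := interior {y | inner ℝ n (y - a) ≤ 0 → y ∈ convexHull ℝ (s : Set Plane)} with hU
  -- The support of `φ` may meet the half plane outside the triangle. The cutoff `ψ` agrees with `φ`
  -- on the triangle and vanishes on the rest of the half plane, so the half plane formula for `ψ`
  -- is the claim for `φ`.
  obtain ⟨ψ, hψ, h1, h2, h3⟩ := exists_cutoff hφ.1 (isClosed_hull s) isOpen_interior (U := U)
    fun x hx => mem_interior_iff_mem_nhds.2 (h.eventually_mem_hull hn ha hx.2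
      fun e' he1 he2 he3 hxe => disjoint_left.1 (hφ.2 e' he1 he2 he3) hx.1 hxe)
  have hz : ∀ y, inner ℝ n (y - a) ≤ 0 → y ∉ convexHull ℝ (s : Set Plane) → y ∉ tsupport ψ :=
    fun y hy hys hyt => hys (interior_subset (h2 hyt) hy)
  have e1 : ∫ x in cell s, partialDeriv i φ x = ∫ x in cell s, partialDeriv i ψ x :=
    setIntegral_congr_fun (isOpen_cell s).measurableSet fun x hx =>
      (partialDeriv_eq_of_eqOn (isOpen_cell s) (h3.mono interior_subset) i hx).symm
  have e2 : ∫ x in cell s, partialDeriv i ψ x = ∫ x in Hp, partialDeriv i ψ x := by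
    rw [setIntegral_congr_set (cell_ae_eq_hull s)]
    refine (setIntegral_eq_of_subset_of_forall_sdiff_eq_zero ?_ (fun y hy => h.inner_nonpos hn ha hy)
      fun y hy => ?_).symm
    · exact (isClosed_le (f := fun y : Plane => inner ℝ n (y - a)) (by fun_prop)
        continuous_const).measurableSet
    · exact image_eq_zero_of_notMem_tsupport fun hc =>
        hz y hy.1 hy.2 (tsupport_partialDeriv_subset ψ i hc)
  have e3 : ∫ x, φ x ∂(arc e) =
      ∫ y, ψ y ∂((Measure.hausdorffMeasure 1).restrict {y | inner ℝ n (y - a) = 0}) := by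
    have hm : MeasurableSet (edge e) := (isClosed_hull e).measurableSet
    rw [arc, setIntegral_congr_fun hm fun x hx =>
      (h3 (edge_subset_hull h.subset hx)).symm]
    refine (setIntegral_eq_of_subset_of_forall_sdiff_eq_zero ?_
      (fun y hy => inner_eq_zero_of_mem_edge hn ha hy) fun y hy => ?_).symm
    · exact (isClosed_eq (by fun_prop) continuous_const).measurableSet
    · exact image_eq_zero_of_notMem_tsupport (hz y (le_of_eq hy.1) fun hc =>
        hy.2 (h.mem_edge_of_inner_eq_zero hn ha hc hy.1))
  rw [e1, e2, integral_partialDeriv_halfPlane hn.1 hψ i, e3]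

/-! ### Piecewise quadratic functions -/

theorem contDiff_eval_mvPolynomial (P : MvPolynomial (Fin 2) ℝ) :
    ContDiff ℝ ∞ fun x : Plane => MvPolynomial.eval (fun i => x i) P := by
  induction P using MvPolynomial.induction_on with
  | C a => simpa using contDiff_const
  | add p q hp hq => simpa using hp.add hq
  | mul_X p i hp =>
    simpa using hp.mul (EuclideanSpace.proj i : Plane →L[ℝ] ℝ).contDiff

theorem IsQuadraticOn.exists_contDiff {s : Finset Plane} {v : Plane → ℝ} (h : IsQuadraticOn s v) :
    ∃ P : Plane → ℝ, ContDiff ℝ ∞ P ∧ v =ᵐ[volume.restrict (cell s)] P := by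
  obtain ⟨P, -, hP⟩ := h
  exact ⟨_, contDiff_eval_mvPolynomial P, hP⟩

theorem IsQuadraticOn.memH2 {s : Finset Plane} {v : Plane → ℝ} (h : IsQuadraticOn s v) :
    MemH2 (cell s) v := by
  obtain ⟨P, hP, hv⟩ := h.exists_contDiff
  exact ((isH2Data_of_contDiff (isBounded_cell s) hP).congr hv.symm).memH2 (isOpen_cell s)

theorem MemH2.lap_congr {U : Set Plane} (hU : IsOpen U) {v w : Plane → ℝ} (hv : MemH2 U v)
    (h : v =ᵐ[volume.restrict U] w) : lap U v =ᵐ[volume.restrict U] lap U w :=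
  (hv.isH2Data.lap_ae_eq hU).trans ((hv.isH2Data.congr h).lap_ae_eq hU).symm

theorem MemH2.congr {U : Set Plane} (hU : IsOpen U) {v w : Plane → ℝ} (hv : MemH2 U v)
    (h : v =ᵐ[volume.restrict U] w) : MemH2 U w :=
  (hv.isH2Data.congr h).memH2 hU

theorem MemH2.restrict {U W : Set Plane} (hW : IsOpen W) (hWU : W ⊆ U) {v : Plane → ℝ}
    (hv : MemH2 U v) : MemH2 W v :=
  (hv.isH2Data.restrict hWU).memH2 hW

/-! ### Triangulations and piecewise H² functions -/

namespace Triangulation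

variable {Ω : Set Plane} (M : Triangulation Ω)

theorem mem_triangles {s : Finset Plane} :
    s ∈ M.triangles ↔ s ∈ M.complex.faces ∧ s.card = 3 := by
  simp [triangles]

theorem mem_edges {e : Finset Plane} : e ∈ M.edges ↔ e ∈ M.complex.faces ∧ e.card = 2 := by
  simp [edges]

theorem mem_adjacent {s e : Finset Plane} : s ∈ M.adjacent e ↔ s ∈ M.triangles ∧ e ⊆ s := by
  simp [adjacent]

theorem isTriangleEdge {s e : Finset Plane} (he : e ∈ M.edges) (hs : s ∈ M.adjacent e) :
    IsTriangleEdge s e := by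
  rw [mem_adjacent, mem_triangles] at hs
  exact ⟨hs.1.2, M.complex.indep hs.1.1, hs.2, (M.mem_edges.1 he).2⟩

theorem card_le_of_mem_faces {s : Finset Plane} (hs : s ∈ M.complex.faces) : s.card ≤ 3 := by
  have h1 := (M.complex.indep hs).card_le_finrank_succ
  have h2 := Submodule.finrank_le (vectorSpan ℝ (range ((↑) : s → Plane)))
  simp at h1 h2
  omega

variable (hΩ : IsPolygonalDomain Ω)

theorem hull_subset_closure {s : Finset Plane} (hs : s ∈ M.complex.faces) :
    convexHull ℝ (s : Set Plane) ⊆ closure Ω := by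
  rw [← M.space_eq]
  exact M.complex.convexHull_subset_space hs

include hΩ in
-- The complex fills only the closure of `Ω`. That open triangles lie in `Ω` itself uses that `Ω` is
-- the interior of its closure.
theorem cell_subset {s : Finset Plane} (hs : s ∈ M.triangles) : cell s ⊆ Ω := by
  rw [← hΩ.interior_closure]
  exact interior_mono (M.hull_subset_closure (M.mem_triangles.1 hs).1)

/-- By conformity two different triangles meet in the hull of their common vertices, of which there
are at most two. -/
theorem interior_inter_hull_eq_empty {s t : Finset Plane} (hs : s ∈ M.triangles)
    (ht : t ∈ M.triangles) (hst : s ≠ t) :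
    interior (convexHull ℝ (s : Set Plane) ∩ convexHull ℝ (t : Set Plane)) = ∅ := by
  classical
  rw [mem_triangles] at hs ht
  rw [M.complex.convexHull_inter_convexHull hs.1 ht.1, ← Finset.coe_inter]
  have h1 : (s ∩ t).card < s.card :=
    Finset.card_lt_card (Finset.ssubset_iff_subset_ne.2 ⟨Finset.inter_subset_left, fun h =>
      hst (Finset.eq_of_subset_of_card_le (Finset.inter_eq_left.1 h) (by rw [hs.2, ht.2]))⟩)
  exact interior_convexHull_of_card_le (by omega)

theorem pairwiseDisjoint_cell : (M.triangles : Set (Finset Plane)).PairwiseDisjoint cell := by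
  intro s hs t ht hst
  rw [Function.onFun, disjoint_iff_inter_eq_empty, cell, cell, ← interior_inter]
  exact M.interior_inter_hull_eq_empty hs ht hst

include hΩ in
-- Every point of `Ω` lies in a face. The boundaries of the triangles and the faces of lower
-- dimension are null sets.
theorem ae_eq_biUnion_cell : Ω =ᵐ[volume] ⋃ s ∈ M.triangles, cell s := by
  refine Filter.EventuallyLE.antisymm ?_
    (LE.le.eventuallyLE (iUnion₂_subset fun s hs => M.cell_subset hΩ hs))
  rw [ae_le_set]
  have hnull : volume (⋃ s ∈ M.complex.faces, convexHull ℝ (s : Set Plane) \ cell s ∪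
      {x | s.card ≠ 3 ∧ x ∈ convexHull ℝ (s : Set Plane)}) = 0 := by
    rw [measure_biUnion_null_iff M.finite.countable]
    intro s hs
    refine measure_union_null ?_ ?_
    · exact ae_le_set.1 (cell_ae_eq_hull s).symm.le
    · by_cases h3 : s.card = 3
      · simp [h3]
      · refine measure_mono_null (fun x hx => hx.2) (volume_convexHull_of_card_le (t := s) ?_)
        have := M.card_le_of_mem_faces hs
        omega
  refine measure_mono_null (fun x hx => ?_) hnull
  have hx1 : x ∈ M.complex.space := M.space_eq ▸ subset_closure hx.1
  obtain ⟨s, hs, hxs⟩ := M.complex.mem_space_iff.1 hx1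
  refine mem_iUnion₂.2 ⟨s, hs, ?_⟩
  by_cases h3 : s.card = 3
  · exact Or.inl ⟨hxs, fun hc => hx.2 (mem_iUnion₂.2 ⟨s, M.mem_triangles.2 ⟨hs, h3⟩, hc⟩)⟩
  · exact Or.inr ⟨h3, hxs⟩

include hΩ in
theorem integral_eq_sum {F : Type*} [NormedAddCommGroup F] [NormedSpace ℝ F] {f : Plane → F}
    (hf : IntegrableOn f Ω) : ∫ x in Ω, f x = ∑ s ∈ M.triangles, ∫ x in cell s, f x := by
  rw [setIntegral_congr_set (M.ae_eq_biUnion_cell hΩ)]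
  exact integral_biUnion_finset _ (fun s _ => (isOpen_cell s).measurableSet)
    M.pairwiseDisjoint_cell fun s hs => hf.mono_set (M.cell_subset hΩ hs)

include hΩ in
theorem ae_restrict_of_cells {p : Plane → Prop}
    (h : ∀ s ∈ M.triangles, ∀ᵐ x ∂volume.restrict (cell s), p x) :
    ∀ᵐ x ∂volume.restrict Ω, p x := by
  rw [Measure.restrict_congr_set (M.ae_eq_biUnion_cell hΩ)]
  rw [ae_restrict_biUnion_finset_iff]
  exact h

theorem ae_restrict_cell (hΩ : IsPolygonalDomain Ω) {s : Finset Plane} (hs : s ∈ M.triangles)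
    {p : Plane → Prop} (h : ∀ᵐ x ∂volume.restrict Ω, p x) : ∀ᵐ x ∂volume.restrict (cell s), p x :=
  ae_restrict_of_ae_restrict_of_subset (M.cell_subset hΩ hs) h

/-- Functions that are `H²` on every triangle. -/
def BrokenH2 (v : Plane → ℝ) : Prop := ∀ s ∈ M.triangles, MemH2 (cell s) v

/-- The piecewise Laplacian. -/
def brokenLap (v : Plane → ℝ) (x : Plane) : ℝ :=
  ∑ s ∈ M.triangles, (cell s).indicator (lap (cell s) v) x

theorem brokenLap_eq {s : Finset Plane} (hs : s ∈ M.triangles) (v : Plane → ℝ) {x : Plane}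
    (hx : x ∈ cell s) : M.brokenLap v x = lap (cell s) v x := by
  rw [brokenLap, Finset.sum_eq_single_of_mem s hs, indicator_of_mem hx]
  intro t ht hts
  exact indicator_of_notMem (fun hxt => disjoint_left.1 (M.pairwiseDisjoint_cell hs ht hts.symm) hx hxt) _

variable {M} {v w : Plane → ℝ}

theorem BrokenH2.memL2_brokenLap (hv : M.BrokenH2 v) (U : Set Plane) : MemL2 U (M.brokenLap v) := by
  refine memLp_finsetSum _ fun s hs => ?_
  rw [memLp_indicator_iff_restrict (isOpen_cell s).measurableSet,
    Measure.restrict_restrict (isOpen_cell s).measurableSet]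
  exact (hv s hs).memL2_lap.mono inter_subset_left

theorem BrokenH2.sub (hv : M.BrokenH2 v) (hw : M.BrokenH2 w) : M.BrokenH2 (v - w) :=
  fun s hs => (hv s hs).sub (isOpen_cell s) (hw s hs)

theorem brokenH2_of_memH2 (hΩ : IsPolygonalDomain Ω) (hv : MemH2 Ω v) : M.BrokenH2 v :=
  fun s hs => hv.restrict (isOpen_cell s) (M.cell_subset hΩ hs)

theorem BrokenH2.congr (hΩ : IsPolygonalDomain Ω) (hv : M.BrokenH2 v)
    (h : v =ᵐ[volume.restrict Ω] w) : M.BrokenH2 w :=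
  fun s hs => (hv s hs).congr (isOpen_cell s) (M.ae_restrict_cell hΩ hs h)

theorem brokenLap_ae_of_cells (hΩ : IsPolygonalDomain Ω) {f : Plane → ℝ}
    (h : ∀ s ∈ M.triangles, lap (cell s) v =ᵐ[volume.restrict (cell s)] f) :
    M.brokenLap v =ᵐ[volume.restrict Ω] f := by
  refine M.ae_restrict_of_cells hΩ fun s hs => ?_
  filter_upwards [h s hs, ae_restrict_mem (isOpen_cell s).measurableSet] with x hx hxs
  rw [M.brokenLap_eq hs v hxs, hx]

theorem BrokenH2.brokenLap_sub (hΩ : IsPolygonalDomain Ω) (hv : M.BrokenH2 v) (hw : M.BrokenH2 w) :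
    M.brokenLap (v - w) =ᵐ[volume.restrict Ω] M.brokenLap v - M.brokenLap w := by
  refine brokenLap_ae_of_cells hΩ fun s hs => ?_
  filter_upwards [(hv s hs).lap_sub (isOpen_cell s) (hw s hs),
    ae_restrict_mem (isOpen_cell s).measurableSet] with x hx hxs
  rw [hx, Pi.sub_apply, Pi.sub_apply, M.brokenLap_eq hs v hxs, M.brokenLap_eq hs w hxs]

theorem BrokenH2.brokenLap_congr (hΩ : IsPolygonalDomain Ω) (hv : M.BrokenH2 v)
    (h : v =ᵐ[volume.restrict Ω] w) :
    M.brokenLap v =ᵐ[volume.restrict Ω] M.brokenLap w := by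
  refine brokenLap_ae_of_cells hΩ fun s hs => ?_
  filter_upwards [(hv s hs).lap_congr (isOpen_cell s) (M.ae_restrict_cell hΩ hs h),
    ae_restrict_mem (isOpen_cell s).measurableSet] with x hx hxs
  rw [hx, M.brokenLap_eq hs w hxs]

theorem brokenLap_ae_eq_lap (hΩ : IsPolygonalDomain Ω) (hv : MemH2 Ω v) :
    M.brokenLap v =ᵐ[volume.restrict Ω] lap Ω v := by
  refine brokenLap_ae_of_cells hΩ fun s hs => ?_
  filter_upwards [(hv.isH2Data.restrict (M.cell_subset hΩ hs)).lap_ae_eq (isOpen_cell s)] with x hx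
  rw [hx, lap]

/-- The piecewise Laplacian is a single function on `Ω`, so the broken form, like `aForm` in
`aForm_eq_l2Inner`, becomes an inner product in one Hilbert space. -/
theorem aTilde_eq_l2Inner (hΩ : IsPolygonalDomain Ω) (hv : M.BrokenH2 v) (hw : M.BrokenH2 w) :
    M.aTilde v w = l2Inner Ω (M.brokenLap v) (M.brokenLap w) := by
  have hint : IntegrableOn (fun x => M.brokenLap v x * M.brokenLap w x) Ω :=
    MemLp.integrable_mul (hv.memL2_brokenLap Ω) (hw.memL2_brokenLap Ω)
  rw [l2Inner, M.integral_eq_sum hΩ hint]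
  refine Finset.sum_congr rfl fun s hs => setIntegral_congr_fun (isOpen_cell s).measurableSet ?_
  intro x hx
  simp only [M.brokenLap_eq hs _ hx]

theorem seminormTwoSq_eq_l2NormSq (hΩ : IsPolygonalDomain Ω) (hv : M.BrokenH2 v) :
    M.seminormTwoSq v = l2NormSq Ω (M.brokenLap v) := by
  rw [l2NormSq_eq_l2Inner, ← aTilde_eq_l2Inner hΩ hv hv]
  exact Finset.sum_congr rfl fun s _ => l2NormSq_eq_l2Inner _ _

theorem aForm_eq_l2Inner (hΩ : IsPolygonalDomain Ω) (hv : MemH2 Ω v) (hw : MemH2 Ω w) :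
    aForm Ω v w = l2Inner Ω (M.brokenLap v) (M.brokenLap w) :=
  l2Inner_congr (brokenLap_ae_eq_lap hΩ hv).symm (brokenLap_ae_eq_lap hΩ hw).symm

end Triangulation

/-! ### Traces of gradients on an edge -/

theorem edge_pair (a b : Plane) : edge {a, b} = segment ℝ a b := by
  simp [edge, convexHull_pair]

theorem arc_univ {e : Finset Plane} (he : e.card = 2) : 0 < arc e univ ∧ arc e univ < ⊤ := by
  obtain ⟨a, b, hab, rfl⟩ := Finset.card_eq_two.1 he
  rw [arc, Measure.restrict_apply_univ, edge_pair, hausdorffMeasure_segment]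
  exact ⟨edist_pos.2 hab, edist_lt_top a b⟩

theorem isFiniteMeasure_arc {e : Finset Plane} (he : e.card = 2) : IsFiniteMeasure (arc e) :=
  ⟨(arc_univ he).2⟩

/-- `t` is the trace on the edge `e` of `∇v`, where `v ∈ H²(T)` has the weak gradient `g` and the
weak Hessian `H` on the triangle `T` with vertex set `s`. -/
def IsGradTrace (s e : Finset Plane) (g : Fin 2 → Plane → ℝ) (H : Fin 2 → Fin 2 → Plane → ℝ)
    (t : Fin 2 → Plane → ℝ) : Prop :=
  (∀ j, MemLp (t j) 2 (arc e)) ∧ ∀ φ, IsAdmissible s e φ → ∀ i j,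
    ∫ x in cell s, (partialDeriv i φ x * g j x + φ x * H j i x) =
      outwardNormal s e i * ∫ x, φ x * t j x ∂(arc e)

theorem integrable_test_mul {U U' : Set Plane} {φ : Plane → ℝ} (h : IsTestFunction U' φ)
    {v : Plane → ℝ} (hv : MemL2 U v) : Integrable (fun x => φ x * v x) (volume.restrict U) :=
  integrable_test_smul h hv

theorem integrable_arc_mul {U : Set Plane} {e : Finset Plane} (he : e.card = 2) {φ : Plane → ℝ}
    (h : IsTestFunction U φ) {v : Plane → ℝ} (hv : MemLp v 2 (arc e)) :
    Integrable (fun x => φ x * v x) (arc e) := by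
  have := isFiniteMeasure_arc he
  exact MemLp.integrable_mul (h.memLp (arc e)) hv

/-- The vector identity is read componentwise. The weak derivatives chosen for the plane-valued
gradient are almost everywhere the columns of `H`. -/
theorem isTrace_weakGrad_iff {s e : Finset Plane} (he : e.card = 2) {v : Plane → ℝ}
    {g : Fin 2 → Plane → ℝ} {H : Fin 2 → Fin 2 → Plane → ℝ} (h : IsH2Data (cell s) v g H)
    (T : Plane → Plane) :
    IsTrace s e (weakGrad (cell s) v) T ↔ IsGradTrace s e g H fun j x => T x j := by
  have hfin := isFiniteMeasure_arc he
  have ho := isOpen_cell s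
  set W := weakGrad (cell s) v with hW
  have hWj : ∀ j, (fun x => W x j) =ᵐ[volume.restrict (cell s)] g j := fun j =>
    h.weakPartial_ae_eq ho j
  have hWm : MemL2 (cell s) W := MemLp.of_eval_piLp fun j =>
    (memLp_congr_ae (hWj j)).2 (h.mem_grad j)
  have hHm : ∀ i, MemL2 (cell s) fun x => (WithLp.toLp 2 fun j => H j i x : Plane) := fun i =>
    MemLp.of_eval_piLp fun j => h.mem_hess j i
  have hWH : ∀ i, IsWeakPartial (cell s) i W fun x => (WithLp.toLp 2 fun j => H j i x : Plane) := by
    intro i φ hφ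
    ext j
    have e1 := (EuclideanSpace.proj j : Plane →L[ℝ] ℝ).integral_comp_comm
      (integrable_test_smul (hφ.pderiv i) hWm)
    have e2 := (EuclideanSpace.proj j : Plane →L[ℝ] ℝ).integral_comp_comm
      (integrable_test_smul hφ (hHm i))
    simp only [PiLp.proj_apply, PiLp.smul_apply] at e1 e2
    rw [PiLp.neg_apply, ← e1, ← e2]
    exact h.hess' ho j i φ hφ
  have hwp : ∀ i, weakPartial (cell s) i W =ᵐ[volume.restrict (cell s)]
      fun x => (WithLp.toLp 2 fun j => H j i x : Plane) := fun i =>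
    (hWH i).weakPartial_ae_eq ho (hHm i)
  have hwm : ∀ i, MemL2 (cell s) (weakPartial (cell s) i W) := fun i =>
    (memLp_congr_ae (hwp i)).2 (hHm i)
  unfold IsTrace IsGradTrace
  rw [memLp_piLp_iff]
  refine and_congr_right fun hT => ?_
  have hTm : MemLp T 2 (arc e) := memLp_piLp_iff.2 hT
  have key : ∀ φ, IsTestFunction univ φ → ∀ i,
      (∫ x in cell s, (partialDeriv i φ x • W x + φ x • weakPartial (cell s) i W x) =
        outwardNormal s e i • ∫ x, φ x • T x ∂(arc e)) ↔
      ∀ j, ∫ x in cell s, (partialDeriv i φ x * g j x + φ x * H j i x) =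
        outwardNormal s e i * ∫ x, φ x * T x j ∂(arc e) := by
    intro φ hφ i
    have e1 : ∀ j, (∫ x in cell s, (partialDeriv i φ x • W x + φ x • weakPartial (cell s) i W x)) j =
        ∫ x in cell s, (partialDeriv i φ x * g j x + φ x * H j i x) := by
      intro j
      have := (EuclideanSpace.proj j : Plane →L[ℝ] ℝ).integral_comp_comm
        ((integrable_test_smul (hφ.pderiv i) hWm).add (integrable_test_smul hφ (hwm i)))
      simp only [PiLp.proj_apply, Pi.add_apply] at this
      rw [← this]
      refine integral_congr_ae ?_
      filter_upwards [hWj j, hwp i] with x h1 h2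
      simp only [PiLp.add_apply, PiLp.smul_apply, smul_eq_mul, h1, h2]
    have e2 : ∀ j, (∫ x, φ x • T x ∂(arc e)) j = ∫ x, φ x * T x j ∂(arc e) := by
      intro j
      have := (EuclideanSpace.proj j : Plane →L[ℝ] ℝ).integral_comp_comm
        (memLp_one_iff_integrable.1 (MemLp.smul (p := 2) (q := 2) hTm (hφ.memLp (arc e))))
      exact this.symm
    constructor
    · intro h1 j
      rw [← e1 j, h1, PiLp.smul_apply, smul_eq_mul, e2 j]
    · intro h1
      ext j
      rw [e1 j, h1 j, PiLp.smul_apply, smul_eq_mul, e2 j]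
  constructor
  · exact fun h1 φ hφ i => (key φ hφ.1 i).1 (h1 φ hφ.1 hφ.2 i)
  · exact fun h1 φ hφ hφ' i => (key φ hφ i).2 (h1 φ ⟨hφ, hφ'⟩ i)

theorem IsGradTrace.sub {s e : Finset Plane} (he : e.card = 2) {g g' : Fin 2 → Plane → ℝ}
    {H H' : Fin 2 → Fin 2 → Plane → ℝ} {t t' : Fin 2 → Plane → ℝ} (h : IsGradTrace s e g H t)
    (h' : IsGradTrace s e g' H' t') (hg : ∀ j, MemL2 (cell s) (g j))
    (hg' : ∀ j, MemL2 (cell s) (g' j)) (hH : ∀ i j, MemL2 (cell s) (H i j))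
    (hH' : ∀ i j, MemL2 (cell s) (H' i j)) : IsGradTrace s e (g - g') (H - H') (t - t') := by
  refine ⟨fun j => (h.1 j).sub (h'.1 j), fun φ hφ i j => ?_⟩
  have i1 := integrable_arc_mul he hφ.1 (h.1 j)
  have i2 := integrable_arc_mul he hφ.1 (h'.1 j)
  simp only [Pi.sub_apply, mul_sub]
  rw [integral_sub i1 i2, mul_sub, ← h.2 φ hφ i j, ← h'.2 φ hφ i j, ← integral_sub]
  · congr 1
    ext x
    ring
  · exact (integrable_test_mul (hφ.1.pderiv i) (hg j)).add (integrable_test_mul hφ.1 (hH j i))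
  · exact (integrable_test_mul (hφ.1.pderiv i) (hg' j)).add (integrable_test_mul hφ.1 (hH' j i))

/-- A smooth multiple of an admissible function is admissible, so this is Gauss' formula for `φ *
partialDeriv j P`. -/
theorem isGradTrace_of_contDiff {s e : Finset Plane} (h : IsTriangleEdge s e) {P : Plane → ℝ}
    (hP : ContDiff ℝ ∞ P) :
    IsGradTrace s e (fun j => partialDeriv j P) (fun j i => partialDeriv i (partialDeriv j P))
      fun j => partialDeriv j P := by
  have hfin := isFiniteMeasure_arc h.card_edge
  refine ⟨fun j => ?_, fun φ hφ i j => ?_⟩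
  · obtain ⟨C, hC⟩ := (e.finite_toSet.isCompact_convexHull ℝ).exists_bound_of_continuousOn
      (contDiff_partialDeriv hP j).continuous.continuousOn
    refine MemLp.of_bound (contDiff_partialDeriv hP j).continuous.aestronglyMeasurable C ?_
    rw [arc, ae_restrict_iff' (show MeasurableSet (edge e) from (isClosed_hull e).measurableSet)]
    exact Filter.Eventually.of_forall hC
  · have := h.integral_partialDeriv (hφ.mul_contDiff (contDiff_partialDeriv hP j)) i
    simpa only [partialDeriv_mul hφ.1.1 (contDiff_partialDeriv hP j), Pi.mul_apply] using this

namespace Triangulation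

variable {Ω : Set Plane} (M : Triangulation Ω)

/-- The union of the faces that do not contain the edge `e`. -/
def offEdge (e : Finset Plane) : Set Plane :=
  ⋃ f ∈ {f ∈ M.complex.faces | ¬e ⊆ f}, convexHull ℝ (f : Set Plane)

theorem isClosed_offEdge (e : Finset Plane) : IsClosed (M.offEdge e) :=
  (M.finite.subset (sep_subset _ _)).isClosed_biUnion fun f _ => isClosed_hull f

theorem hull_subset_offEdge {e f : Finset Plane} (hf : f ∈ M.complex.faces) (hef : ¬e ⊆ f) :
    convexHull ℝ (f : Set Plane) ⊆ M.offEdge e :=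
  subset_biUnion_of_mem (u := fun f : Finset Plane => convexHull ℝ (f : Set Plane))
    (show f ∈ {f ∈ M.complex.faces | ¬e ⊆ f} from ⟨hf, hef⟩)

variable {M} {e : Finset Plane}

/-- A face that does not contain `e` meets it in at most one vertex, and a point has no length. Test
functions that vanish near these faces therefore still determine functions on `e`. -/
theorem arc_offEdge (he : e ∈ M.edges) : arc e (M.offEdge e) = 0 := by
  classical
  rw [offEdge, measure_biUnion_null_iff (M.finite.subset (sep_subset _ _)).countable]
  rintro f ⟨hf, hef⟩
  have he' := M.mem_edges.1 he
  rw [arc, Measure.restrict_apply (isClosed_hull f).measurableSet, edge,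
    M.complex.convexHull_inter_convexHull hf he'.1, ← Finset.coe_inter]
  have hc : (f ∩ e).card ≤ 1 := by
    have : (f ∩ e).card < e.card := Finset.card_lt_card
      (Finset.ssubset_iff_subset_ne.2 ⟨Finset.inter_subset_right, fun h => hef (Finset.inter_eq_right.1 h)⟩)
    omega
  have hs : (convexHull ℝ ((f ∩ e : Finset Plane) : Set Plane)).Subsingleton := by
    rcases Finset.card_le_one_iff_subset_singleton.1 hc with ⟨a, ha⟩
    refine Set.Subsingleton.anti (t := {a}) subsingleton_singleton ?_
    exact convexHull_min (by exact_mod_cast ha) (convex_singleton a)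
  have := Measure.nullSingletonClass_hausdorff Plane (d := 1) one_pos
  exact hs.measure_zero _

theorem mem_offEdge_of_mem_edge {s e' : Finset Plane} (he : e ∈ M.edges) (hs : s ∈ M.adjacent e)
    (he's : e' ⊆ s) (hcard : e'.card = 2) (hne : e' ≠ e) : edge e' ⊆ M.offEdge e := by
  have hs' := (M.mem_triangles.1 (M.mem_adjacent.1 hs).1).1
  refine M.hull_subset_offEdge (M.complex.down_closed hs' he's (Finset.card_pos.1 (by omega))) ?_
  exact fun h => hne (Finset.eq_of_subset_of_card_le h (by rw [hcard, (M.mem_edges.1 he).2])).symm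

theorem isAdmissible_of_disjoint {s : Finset Plane} (he : e ∈ M.edges) (hs : s ∈ M.adjacent e)
    {φ : Plane → ℝ} (hφ : IsTestFunction univ φ) (h : Disjoint (tsupport φ) (M.offEdge e)) :
    IsAdmissible s e φ :=
  ⟨hφ, fun _ h1 h2 h3 => h.mono_right (mem_offEdge_of_mem_edge he hs h1 h2 h3)⟩

/-- The fundamental lemma of the calculus of variations on an edge. -/
theorem ae_eq_zero_of_integral_arc (he : e ∈ M.edges) {f : Plane → ℝ} (hf : MemLp f 2 (arc e))
    (h : ∀ φ, IsTestFunction univ φ → Disjoint (tsupport φ) (M.offEdge e) →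
      ∫ x, φ x * f x ∂(arc e) = 0) : f =ᵐ[arc e] 0 := by
  have hfin := isFiniteMeasure_arc (M.mem_edges.1 he).2
  have h1 := (M.isClosed_offEdge e).isOpen_compl.ae_eq_zero_of_integral_contDiff_smul_eq_zero
    (μ := arc e) ((hf.locallyIntegrable (by norm_num)).locallyIntegrableOn _)
    fun g hg hc hs => h g ⟨hg, hc, subset_univ _⟩ (disjoint_left.2 fun x hx => hs hx)
  have h2 : ∀ᵐ x ∂(arc e), x ∉ M.offEdge e := measure_eq_zero_iff_ae_notMem.1 (arc_offEdge he)
  filter_upwards [h1, h2] with x hx hx' using hx hx'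

theorem isGradTrace_ae_eq {s : Finset Plane} (he : e ∈ M.edges)
    (hs : s ∈ M.adjacent e) {g : Fin 2 → Plane → ℝ} {H : Fin 2 → Fin 2 → Plane → ℝ}
    {t t' : Fin 2 → Plane → ℝ} (h : IsGradTrace s e g H t) (h' : IsGradTrace s e g H t') (j : Fin 2) :
    t j =ᵐ[arc e] t' j := by
  have h2 := (M.mem_edges.1 he).2
  have h0 : t j - t' j =ᵐ[arc e] 0 := by
    refine ae_eq_zero_of_integral_arc he ((h.1 j).sub (h'.1 j)) fun φ hφ hd => ?_
    have ha := isAdmissible_of_disjoint he hs hφ hd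
    have hu := unit_sq (M.isTriangleEdge he hs).isOutwardNormal.1
    have e0 := (h.2 φ ha 0 j).symm.trans (h'.2 φ ha 0 j)
    have e1 := (h.2 φ ha 1 j).symm.trans (h'.2 φ ha 1 j)
    simp only [Pi.sub_apply, mul_sub]
    rw [integral_sub (integrable_arc_mul h2 hφ (h.1 j)) (integrable_arc_mul h2 hφ (h'.1 j))]
    -- Either component of the normal may vanish, so the identities for both directions are weighted
    -- with these components, whose squares add up to 1.
    linear_combination outwardNormal s e 0 * e0 + outwardNormal s e 1 * e1 -
      (∫ x, φ x * t j x ∂(arc e) - ∫ x, φ x * t' j x ∂(arc e)) * hu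
  filter_upwards [h0] with x hx using sub_eq_zero.1 hx

/-- Traces are unique almost everywhere on `e`, so the choice made in `trace` does not matter once
some trace exists. -/
theorem normalDeriv_ae_eq {s : Finset Plane} (he : e ∈ M.edges) (hs : s ∈ M.adjacent e)
    {v : Plane → ℝ} {g : Fin 2 → Plane → ℝ} {H : Fin 2 → Fin 2 → Plane → ℝ}
    (h : IsH2Data (cell s) v g H) {t : Fin 2 → Plane → ℝ} (ht : IsGradTrace s e g H t) :
    normalDeriv s e v =ᵐ[arc e] fun x => ∑ j, t j x * outwardNormal s e j := by
  have h2 := (M.mem_edges.1 he).2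
  have hex : ∃ T, IsTrace s e (weakGrad (cell s) v) T :=
    ⟨fun x => WithLp.toLp 2 fun j => t j x, (isTrace_weakGrad_iff h2 h _).2 ht⟩
  have hT := (isTrace_weakGrad_iff h2 h _).1 hex.choose_spec
  have hall : ∀ᵐ x ∂(arc e), ∀ j, hex.choose x j = t j x :=
    ae_all_iff.2 fun j => isGradTrace_ae_eq he hs hT ht j
  filter_upwards [hall] with x hx
  simp only [normalDeriv, trace, dif_pos hex, inner_plane, Fin.sum_univ_two, hx]

theorem normalDeriv_eq_zero {s : Finset Plane} (he : e ∈ M.edges)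
    {v : Plane → ℝ} {g : Fin 2 → Plane → ℝ} {H : Fin 2 → Fin 2 → Plane → ℝ}
    (h : IsH2Data (cell s) v g H) (ht : ¬∃ t, IsGradTrace s e g H t) (x : Plane) :
    normalDeriv s e v x = 0 := by
  have hex : ¬∃ T, IsTrace s e (weakGrad (cell s) v) T := fun ⟨T, hT⟩ =>
    ht ⟨_, (isTrace_weakGrad_iff (M.mem_edges.1 he).2 h T).1 hT⟩
  simp [normalDeriv, trace, dif_neg hex]

end Triangulation

/-! ### Jumps of the normal derivative -/

theorem partialDeriv_neg (φ : Plane → ℝ) (i : Fin 2) :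
    partialDeriv i (-φ) = -partialDeriv i φ := by
  ext x
  simp [partialDeriv, fderiv_neg]

namespace Triangulation

variable {Ω : Set Plane} {M : Triangulation Ω} {e : Finset Plane}

theorem exists_mem_edge_notMem_offEdge (he : e ∈ M.edges) : ∃ x ∈ edge e, x ∉ M.offEdge e := by
  by_contra! h
  have h1 : arc e univ ≤ arc e (M.offEdge e) := by
    rw [arc, Measure.restrict_apply_univ, Measure.restrict_apply (M.isClosed_offEdge e).measurableSet]
    exact measure_mono fun x hx => ⟨h x hx, hx⟩
  rw [arc_offEdge he] at h1
  exact (arc_univ (M.mem_edges.1 he).2).1.ne' (le_antisymm h1 zero_le)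

theorem notMem_edge_of_notMem_offEdge {s : Finset Plane} (he : e ∈ M.edges) (hs : s ∈ M.adjacent e)
    {x : Plane} (hx : x ∉ M.offEdge e) : ∀ e' ⊆ s, e'.card = 2 → e' ≠ e → x ∉ edge e' :=
  fun _ h1 h2 h3 h4 => hx (mem_offEdge_of_mem_edge he hs h1 h2 h3 h4)

/-- The normals agree up to sign. If they were equal, both triangles would contain the same half
neighbourhood of a point of `e` off the other faces, although their interiors are disjoint. -/
theorem outwardNormal_eq_neg {s s' : Finset Plane} (he : e ∈ M.edges) (hs : s ∈ M.adjacent e)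
    (hs' : s' ∈ M.adjacent e) (hne : s ≠ s') : outwardNormal s e = -outwardNormal s' e := by
  have h := M.isTriangleEdge he hs
  have h' := M.isTriangleEdge he hs'
  have hn := h.isOutwardNormal
  have hn' := h'.isOutwardNormal
  obtain ⟨a, b, hab, heab⟩ := h.exists_vertices
  have ha : a ∈ e := by simp [heab]
  have hb : b ∈ e := by simp [heab]
  refine (eq_or_eq_neg_of_unit_orthogonal hn.1 hn'.1 (sub_ne_zero.2 hab) (hn.2.1 a ha b hb)
    (hn'.2.1 a ha b hb)).resolve_left fun heq => ?_
  obtain ⟨x, hx, hxo⟩ := exists_mem_edge_notMem_offEdge he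
  have ev := h.eventually_mem_hull hn ha (edge_subset_hull h.subset hx)
    (notMem_edge_of_notMem_offEdge he hs hxo)
  have ev' := h'.eventually_mem_hull hn' ha (edge_subset_hull h'.subset hx)
    (notMem_edge_of_notMem_offEdge he hs' hxo)
  rw [← heq] at ev' hn'
  set n := outwardNormal s e
  obtain ⟨W, hW, hWo, hxW⟩ := eventually_nhds_iff.1 (ev.and ev')
  have hlim : Filter.Tendsto (fun t : ℝ => x - t • n) (nhdsWithin 0 (Ioi 0)) (nhds x) := by
    have : Continuous fun t : ℝ => x - t • n := by fun_prop
    have h0 := this.tendsto 0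
    simp only [zero_smul, sub_zero] at h0
    exact h0.mono_left nhdsWithin_le_nhds
  obtain ⟨t, htW, ht⟩ := ((hlim.eventually (hWo.mem_nhds hxW)).and self_mem_nhdsWithin).exists
  have hyn : inner ℝ n (x - t • n - a) < 0 := by
    have h1 := inner_eq_zero_of_mem_edge hn ha hx
    have h2 : x - t • n - a = (x - a) - t • n := by abel
    rw [h2, inner_sub_right, h1, real_inner_smul_right, real_inner_self_eq_norm_sq, hn.1]
    simpa using ht
  have hO : IsOpen (W ∩ {y | inner ℝ n (y - a) < 0}) :=
    hWo.inter (isOpen_lt (f := fun y : Plane => inner ℝ n (y - a)) (by fun_prop) continuous_const)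
  have hsub : W ∩ {y | inner ℝ n (y - a) < 0} ⊆
      interior (convexHull ℝ (s : Set Plane) ∩ convexHull ℝ (s' : Set Plane)) :=
    hO.subset_interior_iff.2 fun y hy => ⟨(hW y hy.1).1 (le_of_lt hy.2), (hW y hy.1).2 (le_of_lt hy.2)⟩
  rw [M.interior_inter_hull_eq_empty (M.mem_adjacent.1 hs).1 (M.mem_adjacent.1 hs').1 hne] at hsub
  exact hsub ⟨htW, hyn⟩

/-- A face that misses a vertex `v` of `e` meets the triangle inside the edge opposite to `v`, and
admissible functions vanish near that edge. -/
theorem notMem_offEdge_of_isAdmissible {s : Finset Plane} (he : e ∈ M.edges)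
    (hs : s ∈ M.adjacent e) {φ : Plane → ℝ} (hφ : IsAdmissible s e φ) {x : Plane}
    (hx : x ∈ tsupport φ) (hxs : x ∈ convexHull ℝ (s : Set Plane)) : x ∉ M.offEdge e := by
  classical
  intro hxo
  obtain ⟨f, ⟨hf, hef⟩, hxf⟩ := mem_iUnion₂.1 hxo
  have h := M.isTriangleEdge he hs
  obtain ⟨v, hve, hvf⟩ := Finset.not_subset.1 hef
  have hx' : x ∈ edge (s.erase v) := by
    have : x ∈ convexHull ℝ (s ∩ f : Set Plane) := by
      rw [← M.complex.convexHull_inter_convexHull (M.mem_triangles.1 (M.mem_adjacent.1 hs).1).1 hf]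
      exact ⟨hxs, hxf⟩
    refine convexHull_mono (fun y hy => ?_) this
    rw [Finset.coe_erase]
    exact ⟨hy.1, fun hyv => hvf (hyv ▸ hy.2)⟩
  refine disjoint_left.1 (hφ.2 (s.erase v) (Finset.erase_subset _ _) ?_ ?_) hx hx'
  · rw [Finset.card_erase_of_mem (h.subset hve), h.card]
  · intro h1
    rw [← h1] at hve
    simp at hve

/-- The traces from the two sides of an interior edge agree: a trace of `∇v` taken from one
of the adjacent triangles is a trace from the other one. -/
theorem isGradTrace_of_adjacent (hΩ : IsPolygonalDomain Ω) {s s' : Finset Plane} (he : e ∈ M.edges)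
    (hs : s ∈ M.adjacent e) (hs' : s' ∈ M.adjacent e) (hne : s ≠ s') {v : Plane → ℝ}
    {g : Fin 2 → Plane → ℝ} {H : Fin 2 → Fin 2 → Plane → ℝ} (hv : IsH2Data Ω v g H)
    {t : Fin 2 → Plane → ℝ} (ht : IsGradTrace s e g H t) : IsGradTrace s' e g H t := by
  refine ⟨ht.1, fun φ hφ i j => ?_⟩
  have h := M.isTriangleEdge he hs
  have h' := M.isTriangleEdge he hs'
  have hneg := outwardNormal_eq_neg he hs hs' hne
  have hn := h.isOutwardNormal
  have hn' := h'.isOutwardNormal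
  have hst := (M.mem_adjacent.1 hs).1
  have hst' := (M.mem_adjacent.1 hs').1
  obtain ⟨a, b, -, heab⟩ := h.exists_vertices
  have ha : a ∈ e := by simp [heab]
  set B := convexHull ℝ (s : Set Plane) ∪ convexHull ℝ (s' : Set Plane) with hB
  -- Off `e`, the triangle `s'` is itself a neighbourhood of such a point. On `e`, the two triangles
  -- contain opposite half neighbourhoods, so their union is a neighbourhood.
  have hK : tsupport φ ∩ convexHull ℝ (s' : Set Plane) ⊆ (M.offEdge e)ᶜ ∩ interior B := by
    rintro x ⟨hx, hxs⟩
    have hxo := notMem_offEdge_of_isAdmissible he hs' hφ hx hxs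
    refine ⟨hxo, mem_interior_iff_mem_nhds.2 ?_⟩
    have ev' := h'.eventually_mem_hull hn' ha hxs (notMem_edge_of_notMem_offEdge he hs' hxo)
    rcases (h'.inner_nonpos hn' ha hxs).lt_or_eq with hlt | heq
    · have hc : Continuous fun y : Plane => inner ℝ (outwardNormal s' e) (y - a) := by fun_prop
      filter_upwards [ev', hc.continuousAt.eventually_lt continuousAt_const hlt] with y h1 h2
      exact Or.inr (h1 h2.le)
    · have hxe := h'.mem_edge_of_inner_eq_zero hn' ha hxs heq
      have ev := h.eventually_mem_hull hn ha (edge_subset_hull h.subset hxe)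
        (notMem_edge_of_notMem_offEdge he hs hxo)
      filter_upwards [ev, ev'] with y h1 h2
      rcases le_total (inner ℝ (outwardNormal s' e) (y - a)) 0 with h3 | h3
      · exact Or.inr (h2 h3)
      · refine Or.inl (h1 ?_)
        rw [hneg, inner_neg_left]
        linarith
  obtain ⟨ψ, hψ, h1, h2, h3⟩ := exists_cutoff hφ.1 (isClosed_hull s')
    ((M.isClosed_offEdge e).isOpen_compl.inter isOpen_interior) hK
  have hψa : IsAdmissible s e ψ :=
    isAdmissible_of_disjoint he hs hψ (disjoint_left.2 fun x hx => (h2 hx).1)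
  have hψΩ : IsTestFunction Ω ψ := hψ.of_univ fun x hx => by
    rw [← hΩ.interior_closure]
    exact interior_mono (union_subset (M.hull_subset_closure (M.mem_triangles.1 hst).1)
      (M.hull_subset_closure (M.mem_triangles.1 hst').1)) (h2 hx).2
  have i1 := integrable_test_mul (hψ.pderiv i) (hv.mem_grad j)
  have i2 := integrable_test_mul hψ (hv.mem_hess j i)
  -- Since `ψ` is supported inside `Ω`, this is the definition of the weak Hessian. The
  -- contributions of the two triangles cancel, and so do the signs of their normals.
  have hzero : ∫ x in Ω, (partialDeriv i ψ x * g j x + ψ x * H j i x) = 0 := by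
    rw [integral_add i1 i2]
    have := hv.hess j i ψ hψΩ
    simp only [smul_eq_mul] at this
    rw [this, neg_add_cancel]
  have hsplit : ∫ x in Ω, (partialDeriv i ψ x * g j x + ψ x * H j i x) =
      (∫ x in cell s, (partialDeriv i ψ x * g j x + ψ x * H j i x)) +
        ∫ x in cell s', (partialDeriv i ψ x * g j x + ψ x * H j i x) := by
    have hi : IntegrableOn (fun x => partialDeriv i ψ x * g j x + ψ x * H j i x) Ω := i1.add i2
    rw [← setIntegral_union (M.pairwiseDisjoint_cell hst hst' hne) (isOpen_cell s').measurableSet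
      (hi.mono_set (M.cell_subset hΩ hst)) (hi.mono_set (M.cell_subset hΩ hst'))]
    refine setIntegral_eq_of_subset_of_ae_sdiff_eq_zero hΩ.isOpen.measurableSet.nullMeasurableSet
      (union_subset (M.cell_subset hΩ hst) (M.cell_subset hΩ hst')) ?_
    filter_upwards [(cell_ae_eq_hull s).mem_iff, (cell_ae_eq_hull s').mem_iff] with x e1 e2 hx
    have hxt : x ∉ tsupport ψ := fun hxt => by
      rcases interior_subset (h2 hxt).2 with h4 | h4
      · exact hx.2 (Or.inl (e1.2 h4))
      · exact hx.2 (Or.inr (e2.2 h4))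
    rw [image_eq_zero_of_notMem_tsupport hxt, image_eq_zero_of_notMem_tsupport fun hc =>
      hxt (tsupport_partialDeriv_subset ψ i hc)]
    simp
  have hcongr : ∫ x in cell s', (partialDeriv i ψ x * g j x + ψ x * H j i x) =
      ∫ x in cell s', (partialDeriv i φ x * g j x + φ x * H j i x) := by
    refine setIntegral_congr_fun (isOpen_cell s').measurableSet fun x hx => ?_
    have e1 := h3 (interior_subset hx)
    have e2 := partialDeriv_eq_of_eqOn (isOpen_cell s') (h3.mono interior_subset) i hx
    simp only [e1, e2]
  have harc : ∫ x, ψ x * t j x ∂(arc e) = ∫ x, φ x * t j x ∂(arc e) := by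
    have hm : MeasurableSet (edge e) := (isClosed_hull e).measurableSet
    refine setIntegral_congr_fun hm fun x hx => ?_
    simp only [h3 (edge_subset_hull h'.subset hx)]
  have hfin := ht.2 ψ hψa i j
  rw [hsplit, hfin, hcongr, harc, hneg, PiLp.neg_apply] at hzero
  linarith

/-- The normal derivative of a function in `Q` does not jump, in terms of given traces. -/
theorem sum_normal_trace_eq_zero (hΩ : IsPolygonalDomain Ω) (he : e ∈ M.edges) {q : Plane → ℝ}
    (hq : MemQ Ω q) {t : Finset Plane → Fin 2 → Plane → ℝ}
    (ht : ∀ s ∈ M.adjacent e, IsGradTrace s e (fun i => weakPartial Ω i q)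
      (fun i j => weakPartial Ω j (weakPartial Ω i q)) (t s)) :
    (fun x => ∑ s ∈ M.adjacent e, ∑ j, t s j x * outwardNormal s e j) =ᵐ[arc e] 0 := by
  have h2 := (M.mem_edges.1 he).2
  have hm : ∀ s ∈ M.adjacent e, MemLp (fun x => ∑ j, t s j x * outwardNormal s e j) 2 (arc e) :=
    fun s hs => memLp_finsetSum _ fun j _ => ((ht s hs).1 j).mul_const _
  refine ae_eq_zero_of_integral_arc he (memLp_finsetSum _ hm) fun φ hφ hd => ?_
  have i1 := fun i => integrable_test_mul (hφ.pderiv i) (hq.1.isH2Data.mem_grad i)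
  have i2 := fun i => integrable_test_mul hφ (hq.1.isH2Data.mem_hess i i)
  have hi : ∀ i, IntegrableOn (fun x => partialDeriv i φ x * weakPartial Ω i q x +
      φ x * weakPartial Ω i (weakPartial Ω i q) x) Ω := fun i => (i1 i).add (i2 i)
  have hs : ∀ s ∈ M.adjacent e, ∫ x, φ x * ∑ j, t s j x * outwardNormal s e j ∂(arc e) =
      ∑ i, ∫ x in cell s, (partialDeriv i φ x * weakPartial Ω i q x +
        φ x * weakPartial Ω i (weakPartial Ω i q) x) := by
    intro s hs
    have ha := isAdmissible_of_disjoint he hs hφ hd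
    simp only [Finset.mul_sum]
    rw [integral_finsetSum _ fun j _ => integrable_arc_mul h2 hφ (((ht s hs).1 j).mul_const _)]
    refine Finset.sum_congr rfl fun i _ => ?_
    rw [(ht s hs).2 φ ha i i, mul_comm, ← integral_mul_const]
    simp only [mul_assoc]
  simp only [Finset.mul_sum]
  have hs0 : ∀ s ∈ M.triangles, s ∉ M.adjacent e → ∀ i, ∫ x in cell s,
      (partialDeriv i φ x * weakPartial Ω i q x + φ x * weakPartial Ω i (weakPartial Ω i q) x) = 0 := by
    intro s hst hsa i
    refine setIntegral_eq_zero_of_forall_eq_zero fun x hx => ?_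
    have hxt : x ∉ tsupport φ := fun hxt => disjoint_left.1 hd hxt
      (M.hull_subset_offEdge (M.mem_triangles.1 hst).1
        (fun hes => hsa (M.mem_adjacent.2 ⟨hst, hes⟩)) (interior_subset hx))
    rw [image_eq_zero_of_notMem_tsupport hxt, image_eq_zero_of_notMem_tsupport fun hc =>
      hxt (tsupport_partialDeriv_subset φ i hc)]
    simp
  -- The test functions in the definition of Q need not vanish on the boundary of `Ω`, so interior
  -- and boundary edges are covered alike. Only the triangles adjacent to `e` contribute, each with
  -- its boundary integral over `e`.
  have hgreen := hq.2 φ hφ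
  have hre : ∫ x in Ω, ((∑ i, weakPartial Ω i q x * partialDeriv i φ x) + lap Ω q x * φ x) =
      ∑ i, ∫ x in Ω, (partialDeriv i φ x * weakPartial Ω i q x +
        φ x * weakPartial Ω i (weakPartial Ω i q) x) := by
    rw [← integral_finsetSum _ fun i _ => hi i]
    refine integral_congr_ae (Filter.Eventually.of_forall fun x => ?_)
    simp only [lap, Finset.sum_mul, ← Finset.sum_add_distrib]
    exact Finset.sum_congr rfl fun i _ => by ring
  rw [hre] at hgreen
  simp only [M.integral_eq_sum hΩ (hi _)] at hgreen
  rw [Finset.sum_comm] at hgreen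
  have hsub : M.adjacent e ⊆ M.triangles := fun s hs => (M.mem_adjacent.1 hs).1
  rw [← Finset.sum_subset hsub fun s hst hsa => Finset.sum_eq_zero fun i _ => hs0 s hst hsa i,
    ← Finset.sum_congr rfl fun s hs' => hs s hs', ← integral_finsetSum] at hgreen
  · simpa only [Finset.mul_sum] using hgreen
  · exact fun s hs => integrable_arc_mul h2 hφ (hm s hs)

/-- Subtracting a piecewise quadratic function from a function in `Q` does not increase the jump of
the normal derivative: the function in `Q` contributes nothing. By `isGradTrace_of_adjacent` its
gradient has a common trace from all adjacent triangles as soon as it has one from one of them, so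
that no trace theorem is needed. -/
theorem jumpNormSq_sub_le (hΩ : IsPolygonalDomain Ω) (he : e ∈ M.edges) {q p : Plane → ℝ}
    (hq : MemQ Ω q) (hp : ∀ s ∈ M.triangles, IsQuadraticOn s p) :
    M.jumpNormSq e (q - p) ≤ M.jumpNormSq e p := by
  have h2 := (M.mem_edges.1 he).2
  have hqd := hq.1.isH2Data
  have hqs : ∀ s ∈ M.adjacent e, IsH2Data (cell s) q (fun i => weakPartial Ω i q)
      (fun i j => weakPartial Ω j (weakPartial Ω i q)) := fun s hs =>
    hqd.restrict (M.cell_subset hΩ (M.mem_adjacent.1 hs).1)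
  have hpd : ∀ s : Finset Plane, ∃ P : Plane → ℝ, s ∈ M.adjacent e →
      ContDiff ℝ ∞ P ∧ p =ᵐ[volume.restrict (cell s)] P := fun s => by
    by_cases hs : s ∈ M.adjacent e
    · obtain ⟨P, hP⟩ := (hp s (M.mem_adjacent.1 hs).1).exists_contDiff
      exact ⟨P, fun _ => hP⟩
    · exact ⟨0, fun h => absurd h hs⟩
  choose P hP using hpd
  have hps : ∀ s ∈ M.adjacent e, IsH2Data (cell s) p (fun i => partialDeriv i (P s))
      (fun i j => partialDeriv j (partialDeriv i (P s))) := fun s hs =>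
    (isH2Data_of_contDiff (isBounded_cell s) (hP s hs).1).congr (hP s hs).2.symm
  have hpt : ∀ s ∈ M.adjacent e, IsGradTrace s e (fun i => partialDeriv i (P s))
      (fun i j => partialDeriv j (partialDeriv i (P s))) (fun i => partialDeriv i (P s)) :=
    fun s hs => isGradTrace_of_contDiff (M.isTriangleEdge he hs) (hP s hs).1
  by_cases hex : ∃ s ∈ M.adjacent e, ∃ t, IsGradTrace s e (fun i => weakPartial Ω i q)
      (fun i j => weakPartial Ω j (weakPartial Ω i q)) t
  · obtain ⟨s₀, hs₀, t, ht₀⟩ := hex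
    have ht : ∀ s ∈ M.adjacent e, IsGradTrace s e (fun i => weakPartial Ω i q)
        (fun i j => weakPartial Ω j (weakPartial Ω i q)) t := fun s hs => by
      by_cases hss : s₀ = s
      · exact hss ▸ ht₀
      · exact isGradTrace_of_adjacent hΩ he hs₀ hs hss hqd ht₀
    have hsum := sum_normal_trace_eq_zero hΩ he hq (t := fun _ => t) ht
    have hd : ∀ᵐ x ∂(arc e), ∀ s ∈ M.adjacent e, normalDeriv s e (q - p) x =
        (∑ j, t j x * outwardNormal s e j) - normalDeriv s e p x := by
      rw [Filter.eventually_all_finset]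
      intro s hs
      have ht' := (ht s hs).sub h2 (hpt s hs) (hqs s hs).mem_grad (hps s hs).mem_grad
        (hqs s hs).mem_hess (hps s hs).mem_hess
      filter_upwards [normalDeriv_ae_eq he hs ((hqs s hs).sub (hps s hs)) ht',
        normalDeriv_ae_eq he hs (hps s hs) (hpt s hs)] with x h3 h4
      rw [h3, h4, ← Finset.sum_sub_distrib]
      exact Finset.sum_congr rfl fun j _ => by simp [sub_mul]
    refine le_of_eq (integral_congr_ae ?_)
    filter_upwards [hd, hsum] with x h3 h4
    have : M.jumpNormalDeriv e (q - p) x = -M.jumpNormalDeriv e p x := by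
      rw [jumpNormalDeriv, Finset.sum_congr rfl h3, Finset.sum_sub_distrib, h4, jumpNormalDeriv]
      simp
    simp only [this, neg_sq]
  · push Not at hex
    have h0 : ∀ x, M.jumpNormalDeriv e (q - p) x = 0 := fun x => by
      refine Finset.sum_eq_zero fun s hs => normalDeriv_eq_zero he ((hqs s hs).sub (hps s hs)) ?_ x
      rintro ⟨t, ht⟩
      -- Adding the trace of `∇p` is written as subtracting that of `∇(-p)`, to fit
      -- `IsGradTrace.sub`.
      refine hex s hs (t - fun i => partialDeriv i (-P s)) ?_
      have hPn : ContDiff ℝ ∞ (-P s) := (hP s hs).1.neg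
      have ht' := ht.sub h2 (isGradTrace_of_contDiff (M.isTriangleEdge he hs) hPn)
        ((hqs s hs).sub (hps s hs)).mem_grad
        (isH2Data_of_contDiff (isBounded_cell s) hPn).mem_grad
        ((hqs s hs).sub (hps s hs)).mem_hess
        (isH2Data_of_contDiff (isBounded_cell s) hPn).mem_hess
      convert ht' using 1
      · ext i x
        simp [partialDeriv_neg]
      · ext i j x
        simp [partialDeriv_neg]
    have : M.jumpNormSq e (q - p) = 0 := by simp [jumpNormSq, h0]
    rw [this]
    exact integral_nonneg fun x => sq_nonneg _

end Triangulation

/-! ### The abstract stability estimate -/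

/-- The stability estimate behind the comparison of the continuous and the auxiliary problem, in
abstract form: `eq, ef, eφ` are the errors, `Lq, Lf, Lφ` their Laplacians, `dq, du, dφ` the
perturbations and `Dq, Dφ` the Laplacians of the perturbations. -/
theorem stability_estimate {α P : ℝ} (hα : 0 < α) (hP : 0 < P) :
    ∃ K : ℝ, 0 < K ∧ ∀ {X : Type} [NormedAddCommGroup X] [InnerProductSpace ℝ X]
      (eq ef eφ Lq Lf Lφ dq du Dq Dφ : X) (δ : ℝ),
      inner ℝ Lf Lf = -inner ℝ Lq Lf - inner ℝ Dq Lf →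
      inner ℝ Lf Lφ = -inner ℝ Lq Lφ - inner ℝ Dq Lφ →
      inner ℝ Lφ Lf = inner ℝ (ef + eq + dq + du) ef →
      inner ℝ Lφ Lφ = inner ℝ (ef + eq + dq + du) eφ →
      α * inner ℝ Lq Lq + inner ℝ eq eq =
        inner ℝ Lq Lφ + inner ℝ Lq Dφ - inner ℝ (ef + du) eq →
      ‖ef‖ ≤ P * ‖Lf‖ → ‖eφ‖ ≤ P * ‖Lφ‖ →
      ‖dq‖ ≤ δ → ‖du‖ ≤ δ → ‖Dq‖ ≤ δ → ‖Dφ‖ ≤ δ →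
      ‖eq‖ ≤ K * δ ∧ ‖ef‖ ≤ K * δ ∧ ‖eφ‖ ≤ K * δ ∧ ‖Lq‖ ≤ K * δ ∧ ‖Lf‖ ≤ K * δ ∧ ‖Lφ‖ ≤ K * δ := by
  -- Young's inequality absorbs half of the left-hand side of `e6`. `N` is twice the coefficient of
  -- δ² that remains.
  set N := (P + 1) ^ 2 + (3 * P + 1) ^ 2 / α + 10 * P with hN
  have hN0 : 0 ≤ N := by positivity
  set a := √(N / α) with ha
  set b := √N with hb
  have ha0 : 0 ≤ a := Real.sqrt_nonneg _
  have hb0 : 0 ≤ b := Real.sqrt_nonneg _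
  -- A common upper bound for the six constants found at the end. It is fixed before the space `X`,
  -- and so does not depend on the mesh.
  refine ⟨(a + 1) * (1 + P) + b + P * (1 + P) * (b + 2), by positivity, ?_⟩
  intro X _ _ eq ef eφ Lq Lf Lφ dq du Dq Dφ δ h1 h2 h3 h4 h5 hf hφ hdq hdu hDq hDφ
  have hδ : 0 ≤ δ := (norm_nonneg dq).trans hdq
  have cs : ∀ x y : X, |inner ℝ x y| ≤ ‖x‖ * ‖y‖ := abs_real_inner_le_norm
  have hcs : ∀ (x y : X) {r : ℝ}, ‖x‖ ≤ r → |inner ℝ x y| ≤ r * ‖y‖ := fun x y r hr =>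
    (cs x y).trans (mul_le_mul_of_nonneg_right hr (norm_nonneg y))
  have cancel : ∀ {x y : ℝ}, 0 ≤ x → 0 ≤ y → x ^ 2 ≤ y * x → x ≤ y := fun {x y} hx hy h => by
    rcases hx.eq_or_lt with h0 | h0
    · rwa [← h0]
    · rw [sq] at h
      exact le_of_mul_le_mul_right h h0
  -- The state equation tested with its own error.
  have hLf : ‖Lf‖ ≤ ‖Lq‖ + δ := by
    refine cancel (norm_nonneg _) (by positivity) ?_
    rw [← real_inner_self_eq_norm_sq, h1]
    linarith [neg_le_of_abs_le (cs Lq Lf), neg_le_of_abs_le (hcs Dq Lf hDq)]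
  have hef : ‖ef‖ ≤ P * (‖Lq‖ + δ) := hf.trans (mul_le_mul_of_nonneg_left hLf hP.le)
  have heq : ‖eq‖ ≤ ‖ef + eq‖ + ‖ef‖ := by
    have := norm_sub_le (ef + eq) ef
    rwa [add_sub_cancel_left] at this
  have hsum : ‖ef + eq + dq + du‖ ≤ ‖ef + eq‖ + 2 * δ := by
    linarith [norm_add_le (ef + eq + dq) du, norm_add_le (ef + eq) dq]
  -- The adjoint equation tested with its own error. Its right-hand side involves only the sum `ef +
  -- eq`, which the energy identity controls.
  have hLφ : ‖Lφ‖ ≤ P * (‖ef + eq‖ + 2 * δ) := by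
    refine cancel (norm_nonneg _) (by positivity) ?_
    rw [← real_inner_self_eq_norm_sq, h4]
    have e1 := le_of_abs_le (hcs _ eφ hsum)
    have e2 := mul_le_mul_of_nonneg_left hφ (by positivity : 0 ≤ ‖ef + eq‖ + 2 * δ)
    linarith
  -- The control equation contains `inner ℝ Lq Lφ`. The state equation tested with the adjoint error
  -- and the adjoint equation tested with the state error replace it by terms in `ef`, which
  -- complete the square `‖ef + eq‖ ^ 2`.
  have henergy : α * ‖Lq‖ ^ 2 + ‖ef + eq‖ ^ 2 =
      -inner ℝ Dq Lφ - inner ℝ dq ef - inner ℝ du ef + inner ℝ Dφ Lq - inner ℝ du eq := by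
    rw [← real_inner_self_eq_norm_sq, ← real_inner_self_eq_norm_sq]
    simp only [inner_add_left, inner_add_right] at h3 h5 ⊢
    linear_combination h5 + h2 - h3 - real_inner_comm Lφ Lf + real_inner_comm Dφ Lq
  have hbound : α * ‖Lq‖ ^ 2 + ‖ef + eq‖ ^ 2 ≤ N * δ ^ 2 := by
    have e1 := neg_le_of_abs_le (hcs _ Lφ hDq)
    have e2 := neg_le_of_abs_le (hcs _ ef hdq)
    have e3 := neg_le_of_abs_le (hcs _ ef hdu)
    have e4 := le_of_abs_le (hcs _ Lq hDφ)
    have e5 := neg_le_of_abs_le (hcs _ eq hdu)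
    have e6 : α * ‖Lq‖ ^ 2 + ‖ef + eq‖ ^ 2 ≤
        δ * ((P + 1) * ‖ef + eq‖ + (3 * P + 1) * ‖Lq‖ + 5 * P * δ) := by
      have f1 := mul_le_mul_of_nonneg_left hLφ hδ
      have f2 := mul_le_mul_of_nonneg_left hef hδ
      have f3 := mul_le_mul_of_nonneg_left heq hδ
      rw [henergy]
      linarith
    have e7 : (3 * P + 1) * ‖Lq‖ * δ ≤ α / 2 * ‖Lq‖ ^ 2 + (3 * P + 1) ^ 2 / α / 2 * δ ^ 2 := by
      have g1 : 0 ≤ (α * ‖Lq‖ - (3 * P + 1) * δ) ^ 2 / (2 * α) := by positivity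
      have g2 : (α * ‖Lq‖ - (3 * P + 1) * δ) ^ 2 / (2 * α) =
          α / 2 * ‖Lq‖ ^ 2 + (3 * P + 1) ^ 2 / α / 2 * δ ^ 2 - (3 * P + 1) * ‖Lq‖ * δ := by
        field_simp
        ring
      linarith
    have e8 := sq_nonneg (‖ef + eq‖ - (P + 1) * δ)
    rw [hN]
    linarith
  have hA : ‖Lq‖ ≤ a * δ := by
    refine le_of_sq_le_sq ?_ (by positivity)
    rw [mul_pow, Real.sq_sqrt (by positivity), div_mul_eq_mul_div, le_div_iff₀ hα]
    linarith [sq_nonneg ‖ef + eq‖]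
  have hw : ‖ef + eq‖ ≤ b * δ := by
    refine le_of_sq_le_sq ?_ (by positivity)
    rw [mul_pow, Real.sq_sqrt hN0]
    linarith [mul_nonneg hα.le (sq_nonneg ‖Lq‖)]
  have p1 : ‖Lf‖ ≤ (a + 1) * δ := by linarith
  have p2 : ‖ef‖ ≤ P * ((a + 1) * δ) := hf.trans (mul_le_mul_of_nonneg_left p1 hP.le)
  have p3 : ‖Lφ‖ ≤ P * ((b + 2) * δ) :=
    hLφ.trans (mul_le_mul_of_nonneg_left (by linarith) hP.le)
  have p4 : ‖eφ‖ ≤ P * (P * ((b + 2) * δ)) := hφ.trans (mul_le_mul_of_nonneg_left p3 hP.le)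
  have q1 : 0 ≤ a * δ := by positivity
  have q2 : 0 ≤ b * δ := by positivity
  have q3 : 0 ≤ P * (a * δ) := by positivity
  have q4 : 0 ≤ P * (b * δ) := by positivity
  have q5 : 0 ≤ P * (P * (b * δ)) := by positivity
  have q6 : 0 ≤ P * δ := by positivity
  have q7 : 0 ≤ P * (P * δ) := by positivity
  refine ⟨?_, ?_, ?_, ?_, ?_, ?_⟩ <;> linarith

/-! ### The energy norm and the passage to classes in L₂ -/

namespace Triangulation

variable {Ω : Set Plane} {M : Triangulation Ω}

/-- The jumps of `q - p` are bounded by those of `p`, and a sum of squares of nonnegative numbers is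
at most the square of their sum. -/
theorem energyNorm_sub_le (hΩ : IsPolygonalDomain Ω) {σ : ℝ} (hσ : 0 ≤ σ) {q p : Plane → ℝ}
    (hq : MemQ Ω q) (hp : ∀ s ∈ M.triangles, IsQuadraticOn s p) :
    M.energyNorm σ (q - p) ≤ √(l2NormSq Ω (M.brokenLap (q - p))) + √(l2NormSq Ω (q - p)) +
      ∑ e ∈ M.edges, √(σ / edgeLength e) * M.jumpNorm e p := by
  have hpb : M.BrokenH2 p := fun s hs => (hp s hs).memH2
  have hw : ∀ e, 0 ≤ σ / edgeLength e := fun e => div_nonneg hσ Metric.diam_nonneg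
  set J := ∑ e ∈ M.edges, √(σ / edgeLength e) * M.jumpNorm e p with hJ
  have hJ0 : ∀ e ∈ M.edges, 0 ≤ √(σ / edgeLength e) * M.jumpNorm e p := fun e _ =>
    mul_nonneg (Real.sqrt_nonneg _) (Real.sqrt_nonneg _)
  have hjump : ∑ e ∈ M.edges, σ / edgeLength e * M.jumpNormSq e (q - p) ≤ J ^ 2 := by
    refine le_trans (Finset.sum_le_sum fun e he => ?_) (Finset.sum_sq_le_sq_sum_of_nonneg hJ0)
    rw [mul_pow, Real.sq_sqrt (hw e), jumpNorm,
      Real.sq_sqrt (show 0 ≤ M.jumpNormSq e p from integral_nonneg fun x => sq_nonneg _)]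
    exact mul_le_mul_of_nonneg_left (jumpNormSq_sub_le hΩ he hq hp) (hw e)
  have hsem := seminormTwoSq_eq_l2NormSq hΩ ((brokenH2_of_memH2 hΩ hq.1).sub hpb)
  have a0 := Real.sqrt_nonneg (l2NormSq Ω (M.brokenLap (q - p)))
  have b0 := Real.sqrt_nonneg (l2NormSq Ω (q - p))
  have c0 : 0 ≤ J := Finset.sum_nonneg hJ0
  have a1 := Real.sq_sqrt (l2NormSq_nonneg Ω (M.brokenLap (q - p)))
  have b1 := Real.sq_sqrt (l2NormSq_nonneg Ω (q - p))
  rw [energyNorm]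
  refine Real.sqrt_le_iff.2 ⟨by positivity, ?_⟩
  have hN : M.normHSq σ (q - p) = M.seminormTwoSq (q - p) +
    ∑ e ∈ M.edges, σ / edgeLength e * M.jumpNormSq e (q - p) := rfl
  rw [hN, hsem]
  nlinarith [mul_nonneg a0 b0, mul_nonneg a0 c0, mul_nonneg b0 c0]

theorem le_normTwo (hΩ : IsPolygonalDomain Ω) {v : Plane → ℝ} (hv : M.BrokenH2 v) :
    √(l2NormSq Ω (M.brokenLap v)) ≤ M.normTwo v ∧ √(l2NormSq Ω v) ≤ M.normTwo v := by
  rw [normTwo, seminormTwoSq_eq_l2NormSq hΩ hv]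
  exact ⟨Real.sqrt_le_sqrt (le_add_of_nonneg_right (l2NormSq_nonneg _ _)),
    Real.sqrt_le_sqrt (le_add_of_nonneg_left (l2NormSq_nonneg _ _))⟩

end Triangulation

open Classical in
/-- The class of a function in `L²(U)`. -/
def l2Class (U : Set Plane) (v : Plane → ℝ) : Lp ℝ 2 (volume.restrict U) :=
  if h : MemL2 U v then MemLp.toLp v h else 0

section L2Class

variable {U : Set Plane} {v w : Plane → ℝ}

theorem MemL2.l2Class_eq (hv : MemL2 U v) : l2Class U v = MemLp.toLp v hv := dif_pos hv

theorem l2Inner_eq_inner_l2Class (hv : MemL2 U v) (hw : MemL2 U w) :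
    l2Inner U v w = inner ℝ (l2Class U v) (l2Class U w) := by
  rw [hv.l2Class_eq, hw.l2Class_eq, l2Inner_eq_inner hv hw]

theorem sqrt_l2NormSq (hv : MemL2 U v) : √(l2NormSq U v) = ‖l2Class U v‖ := by
  rw [hv.l2Class_eq, l2NormSq_eq_norm_sq hv, Real.sqrt_sq (norm_nonneg _)]

theorem l2Class_sub (hv : MemL2 U v) (hw : MemL2 U w) :
    l2Class U (v - w) = l2Class U v - l2Class U w := by
  rw [hv.l2Class_eq, hw.l2Class_eq, MemL2.l2Class_eq (MemLp.sub hv hw), MemLp.toLp_sub hv hw]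

theorem l2Class_congr (hv : MemL2 U v) (h : v =ᵐ[volume.restrict U] w) :
    l2Class U v = l2Class U w := by
  have hw : MemL2 U w := (memLp_congr_ae h).1 hv
  rw [hv.l2Class_eq, hw.l2Class_eq]
  exact (MemLp.toLp_eq_toLp_iff hv hw).2 h

end L2Class

namespace Triangulation

variable {Ω : Set Plane} {M : Triangulation Ω}

/-- The class of the piecewise Laplacian in `L²(Ω)`. -/
def lapClass (M : Triangulation Ω) (v : Plane → ℝ) : Lp ℝ 2 (volume.restrict Ω) :=
  l2Class Ω (M.brokenLap v)

theorem BrokenH2.lapClass_sub (hΩ : IsPolygonalDomain Ω) {v w : Plane → ℝ} (hv : M.BrokenH2 v)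
    (hw : M.BrokenH2 w) : M.lapClass (v - w) = M.lapClass v - M.lapClass w := by
  rw [lapClass, l2Class_congr ((hv.sub hw).memL2_brokenLap Ω) (hv.brokenLap_sub hΩ hw),
    l2Class_sub (hv.memL2_brokenLap Ω) (hw.memL2_brokenLap Ω)]
  rfl

theorem BrokenH2.lapClass_congr (hΩ : IsPolygonalDomain Ω) {v w : Plane → ℝ} (hv : M.BrokenH2 v)
    (h : v =ᵐ[volume.restrict Ω] w) : M.lapClass v = M.lapClass w :=
  l2Class_congr (hv.memL2_brokenLap Ω) (hv.brokenLap_congr hΩ h)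

theorem BrokenH2.add {v w : Plane → ℝ} (hv : M.BrokenH2 v) (hw : M.BrokenH2 w) :
    M.BrokenH2 (v + w) := by
  have h0 : M.BrokenH2 0 := fun s _ =>
    (isH2Data_of_contDiff (isBounded_cell s) contDiff_const).memH2 (isOpen_cell s)
  have : v + w = v - (0 - w) := by rw [zero_sub, sub_neg_eq_add]
  rw [this]
  exact hv.sub (h0.sub hw)

theorem aForm_eq_inner (hΩ : IsPolygonalDomain Ω) {v w : Plane → ℝ} (hv : MemH2 Ω v)
    (hw : MemH2 Ω w) : aForm Ω v w = inner ℝ (M.lapClass v) (M.lapClass w) := by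
  rw [aForm_eq_l2Inner (M := M) hΩ hv hw]
  exact l2Inner_eq_inner_l2Class ((brokenH2_of_memH2 hΩ hv).memL2_brokenLap Ω)
    ((brokenH2_of_memH2 hΩ hw).memL2_brokenLap Ω)

theorem aTilde_eq_inner (hΩ : IsPolygonalDomain Ω) {v w : Plane → ℝ} (hv : M.BrokenH2 v)
    (hw : M.BrokenH2 w) : M.aTilde v w = inner ℝ (M.lapClass v) (M.lapClass w) := by
  rw [aTilde_eq_l2Inner hΩ hv hw]
  exact l2Inner_eq_inner_l2Class (hv.memL2_brokenLap Ω) (hw.memL2_brokenLap Ω)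

theorem norm_l2Class_le (hΩ : IsPolygonalDomain Ω) {P : ℝ} (hP : 0 ≤ P)
    (h : ∀ v, MemV Ω v → l2NormSq Ω v ≤ P * l2NormSq Ω (lap Ω v)) {v : Plane → ℝ} (hv : MemV Ω v) :
    ‖l2Class Ω v‖ ≤ √P * ‖M.lapClass v‖ := by
  rw [lapClass, ← sqrt_l2NormSq hv.memH2.1.1,
    ← sqrt_l2NormSq ((brokenH2_of_memH2 hΩ hv.memH2).memL2_brokenLap Ω), ← Real.sqrt_mul hP,
    l2NormSq_congr (brokenLap_ae_eq_lap hΩ hv.memH2)]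
  exact Real.sqrt_le_sqrt (h v hv)

end Triangulation

end Biharmonic

end

/-! ### The error estimate -/

open Biharmonic
theorem lemma6p1 (Ω : Set Plane) (hΩ : IsPolygonalDomain Ω) (α : ℝ) (hα : 0 < α) :
    ∃ C : ℝ, 0 < C ∧
      ∀ f ud : Plane → ℝ, MemL2 Ω f → MemL2 Ω ud →
      ∀ q u uf φ : Plane → ℝ, IsOptimalTriple Ω α f ud q u uf φ →
      ∀ (M : Triangulation Ω) (σ : ℝ), 1 ≤ σ →
      ∀ qh uh ufh φh : Plane → ℝ, M.IsDiscreteTriple σ α f ud qh uh ufh φh →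
      ∀ qa ua ufa φa : Plane → ℝ, M.IsAuxiliaryTriple α f ud qh uh ufh φh qa ua ufa φa →
        M.energyNorm σ (q - qh) + M.energyNorm σ (u - uh) + M.energyNorm σ (φ - φh) ≤
          C * (M.normTwo (qa - qh) + M.normTwo (ua - uh) + M.normTwo (φa - φh)
            + ∑ e ∈ M.edges, √(σ / edgeLength e) *
                (M.jumpNorm e qh + M.jumpNorm e uh + M.jumpNorm e φh)) := by
  obtain ⟨P, hP, hPoinc⟩ := exists_poincare hΩ.isOpen hΩ.isBounded
  obtain ⟨K, hK, hstab⟩ := stability_estimate hα (Real.sqrt_pos.2 hP)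
  -- Of the six norms at the end, four are at most (K + 1)δ and the two for the state at most (2K +
  -- 2)δ, which adds up to (8K + 8)δ. The jump terms only need the factor 1.
  refine ⟨8 * K + 8, by positivity, ?_⟩
  intro f ud hf hud q u uf φ hopt M σ hσ qh uh ufh φh hdis qa ua ufa φa haux
  have hσ0 : 0 ≤ σ := zero_le_one.trans hσ
  have hO := hΩ.isOpen
  have hqhb : M.BrokenH2 qh := fun s hs => (hdis.qh_mem.2 s hs).memH2
  have huhb : M.BrokenH2 uh := fun s hs => (hdis.uh_mem.2 s hs).memH2
  have hφhb : M.BrokenH2 φh := fun s hs => (hdis.φh_mem.2 s hs).memH2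
  have hb : ∀ {v}, MemH2 Ω v → M.BrokenH2 v := fun hv => Triangulation.brokenH2_of_memH2 hΩ hv
  have hufb := hb hopt.uf_mem.memH2
  have hufab := hb haux.ufa_mem.memH2
  have huab : M.BrokenH2 ua := (hufab.add hqhb).congr hΩ haux.ua_eq.symm
  have lq := hopt.q_mem.1.1.1
  have lu := hopt.u_mem.1.1.1
  have luf := hopt.uf_mem.memH2.1.1
  have lφ := hopt.φ_mem.memH2.1.1
  have lqh := hdis.qh_mem.1.1
  have luh := hdis.uh_mem.1.1
  have lufh := hdis.ufh_mem.1.1.1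
  have lφh := hdis.φh_mem.1.1.1
  have lqa := haux.qa_mem.1.1.1
  have lua := haux.ua_mem.1
  have lufa := haux.ufa_mem.memH2.1.1
  have lφa := haux.φa_mem.memH2.1.1
  have r1 : l2Class Ω uf = l2Class Ω u - l2Class Ω q := by
    rw [← l2Class_sub lu lq]
    refine l2Class_congr luf ?_
    filter_upwards [hopt.u_eq] with x hx
    simp [hx]
  have r2 : l2Class Ω ufh = l2Class Ω uh - l2Class Ω qh := by
    rw [← l2Class_sub luh lqh]
    refine l2Class_congr lufh ?_
    filter_upwards [hdis.uh_eq] with x hx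
    simp [hx]
  have e3 : ufa =ᵐ[volume.restrict Ω] ua - qh := by
    filter_upwards [haux.ua_eq] with x hx
    simp [hx]
  have r3 : l2Class Ω ufa = l2Class Ω ua - l2Class Ω qh := by
    rw [← l2Class_sub lua lqh]
    exact l2Class_congr lufa e3
  have r4 : M.lapClass uf = M.lapClass u - M.lapClass q := by
    rw [← (hb hopt.u_mem.1).lapClass_sub hΩ (hb hopt.q_mem.1)]
    refine hufb.lapClass_congr hΩ ?_
    filter_upwards [hopt.u_eq] with x hx
    simp [hx]
  have r5 : M.lapClass ufa = M.lapClass ua - M.lapClass qh := by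
    rw [← huab.lapClass_sub hΩ hqhb]
    exact hufab.lapClass_congr hΩ e3
  have hstate : ∀ v, MemV Ω v → inner ℝ (M.lapClass uf) (M.lapClass v) -
      inner ℝ (M.lapClass ufa) (M.lapClass v) =
      inner ℝ (M.lapClass qh) (M.lapClass v) - inner ℝ (M.lapClass q) (M.lapClass v) := by
    intro v hv
    have h1 := hopt.state v hv
    have h2 := haux.state v hv
    rw [Triangulation.aForm_eq_inner (M := M) hΩ hopt.uf_mem.memH2 hv.memH2,
      Triangulation.aForm_eq_inner (M := M) hΩ hopt.q_mem.1 hv.memH2] at h1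
    rw [Triangulation.aForm_eq_inner (M := M) hΩ haux.ufa_mem.memH2 hv.memH2,
      Triangulation.aTilde_eq_inner hΩ hqhb (hb hv.memH2)] at h2
    linarith
  have hadj : ∀ v, MemV Ω v → inner ℝ (M.lapClass φ) (M.lapClass v) -
      inner ℝ (M.lapClass φa) (M.lapClass v) =
      inner ℝ (l2Class Ω u) (l2Class Ω v) - inner ℝ (l2Class Ω uh) (l2Class Ω v) := by
    intro v hv
    have h1 := hopt.adjoint v hv
    have h2 := haux.adjoint v hv
    rw [Triangulation.aForm_eq_inner (M := M) hΩ hopt.φ_mem.memH2 hv.memH2,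
      l2Inner_sub_left lu hud hv.memH2.1.1, l2Inner_eq_inner_l2Class lu hv.memH2.1.1] at h1
    rw [Triangulation.aForm_eq_inner (M := M) hΩ hv.memH2 haux.φa_mem.memH2,
      l2Inner_sub_left luh hud hv.memH2.1.1, l2Inner_eq_inner_l2Class luh hv.memH2.1.1,
      real_inner_comm] at h2
    linarith
  have hctrl : ∀ p, MemQ Ω p → α * (inner ℝ (M.lapClass q) (M.lapClass p) -
      inner ℝ (M.lapClass qa) (M.lapClass p)) - inner ℝ (l2Class Ω qa) (l2Class Ω p) =
      inner ℝ (M.lapClass p) (M.lapClass φ) - inner ℝ (M.lapClass p) (M.lapClass φh) -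
        (inner ℝ (l2Class Ω u) (l2Class Ω p) - inner ℝ (l2Class Ω ufh) (l2Class Ω p)) := by
    intro p hp
    have h1 := hopt.optimality p hp
    have h2 := haux.control p hp
    rw [Triangulation.aForm_eq_inner (M := M) hΩ hopt.q_mem.1 hp.1,
      Triangulation.aForm_eq_inner (M := M) hΩ hp.1 hopt.φ_mem.memH2,
      l2Inner_sub_left lu hud hp.1.1.1, l2Inner_eq_inner_l2Class lu hp.1.1.1] at h1
    rw [Triangulation.aForm_eq_inner (M := M) hΩ haux.qa_mem.1 hp.1,
      Triangulation.aTilde_eq_inner hΩ (hb hp.1) hφhb, l2Inner_sub_left lufh hud hp.1.1.1,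
      l2Inner_eq_inner_l2Class lufh hp.1.1.1, l2Inner_eq_inner_l2Class lqa hp.1.1.1] at h2
    linear_combination h1 - h2
  have nq := Triangulation.le_normTwo hΩ ((hb haux.qa_mem.1).sub hqhb)
  have nu := Triangulation.le_normTwo hΩ (huab.sub huhb)
  have nφ := Triangulation.le_normTwo hΩ ((hb haux.φa_mem.memH2).sub hφhb)
  rw [sqrt_l2NormSq (((hb haux.qa_mem.1).sub hqhb).memL2_brokenLap Ω),
    sqrt_l2NormSq (MemLp.sub lqa lqh), l2Class_sub lqa lqh] at nq
  rw [sqrt_l2NormSq ((huab.sub huhb).memL2_brokenLap Ω),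
    sqrt_l2NormSq (MemLp.sub lua luh), l2Class_sub lua luh] at nu
  rw [sqrt_l2NormSq (((hb haux.φa_mem.memH2).sub hφhb).memL2_brokenLap Ω),
    sqrt_l2NormSq (MemLp.sub lφa lφh), l2Class_sub lφa lφh] at nφ
  change ‖M.lapClass (qa - qh)‖ ≤ _ ∧ _ at nq
  change ‖M.lapClass (ua - uh)‖ ≤ _ ∧ _ at nu
  change ‖M.lapClass (φa - φh)‖ ≤ _ ∧ _ at nφ
  rw [(hb haux.qa_mem.1).lapClass_sub hΩ hqhb] at nq
  rw [huab.lapClass_sub hΩ huhb] at nu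
  rw [(hb haux.φa_mem.memH2).lapClass_sub hΩ hφhb] at nφ
  have nq0 := (norm_nonneg _).trans nq.1
  have nu0 := (norm_nonneg _).trans nu.1
  have nφ0 := (norm_nonneg _).trans nφ.1
  have pf := Triangulation.norm_l2Class_le (M := M) hΩ hP.le hPoinc
    (hopt.uf_mem.sub hO haux.ufa_mem)
  have pφ := Triangulation.norm_l2Class_le (M := M) hΩ hP.le hPoinc
    (hopt.φ_mem.sub hO haux.φa_mem)
  rw [l2Class_sub luf lufa, hufb.lapClass_sub hΩ hufab] at pf
  rw [l2Class_sub lφ lφa, (hb hopt.φ_mem.memH2).lapClass_sub hΩ (hb haux.φa_mem.memH2)] at pφ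
  have jq := Triangulation.energyNorm_sub_le hΩ hσ0 hopt.q_mem hdis.qh_mem.2
  have ju := Triangulation.energyNorm_sub_le hΩ hσ0 hopt.u_mem hdis.uh_mem.2
  -- The adjoint state belongs to V, hence to Q, so its normal derivative does not jump either.
  have jφ := Triangulation.energyNorm_sub_le hΩ hσ0 (hopt.φ_mem.memQ hO) hdis.φh_mem.2
  rw [sqrt_l2NormSq (((hb hopt.q_mem.1).sub hqhb).memL2_brokenLap Ω),
    sqrt_l2NormSq (MemLp.sub lq lqh), l2Class_sub lq lqh] at jq
  rw [sqrt_l2NormSq (((hb hopt.u_mem.1).sub huhb).memL2_brokenLap Ω),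
    sqrt_l2NormSq (MemLp.sub lu luh), l2Class_sub lu luh] at ju
  rw [sqrt_l2NormSq (((hb hopt.φ_mem.memH2).sub hφhb).memL2_brokenLap Ω),
    sqrt_l2NormSq (MemLp.sub lφ lφh), l2Class_sub lφ lφh] at jφ
  change _ ≤ ‖M.lapClass (q - qh)‖ + _ + _ at jq
  change _ ≤ ‖M.lapClass (u - uh)‖ + _ + _ at ju
  change _ ≤ ‖M.lapClass (φ - φh)‖ + _ + _ at jφ
  rw [(hb hopt.q_mem.1).lapClass_sub hΩ hqhb] at jq
  rw [(hb hopt.u_mem.1).lapClass_sub hΩ huhb] at ju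
  rw [(hb hopt.φ_mem.memH2).lapClass_sub hΩ hφhb] at jφ
  -- The equations are tested with the exact and the auxiliary function separately. Their
  -- differences are the equations tested with the errors.
  have s1 := hstate uf hopt.uf_mem
  have s2 := hstate ufa haux.ufa_mem
  have s3 := hstate φ hopt.φ_mem
  have s4 := hstate φa haux.φa_mem
  have a1 := hadj uf hopt.uf_mem
  have a2 := hadj ufa haux.ufa_mem
  have a3 := hadj φ hopt.φ_mem
  have a4 := hadj φa haux.φa_mem
  have c1 := hctrl q hopt.q_mem
  have c2 := hctrl qa haux.qa_mem
  set δ := M.normTwo (qa - qh) + M.normTwo (ua - uh) + M.normTwo (φa - φh) with hδ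
  have dsum : l2Class Ω uf - l2Class Ω ufa + (l2Class Ω q - l2Class Ω qa) +
      (l2Class Ω qa - l2Class Ω qh) + (l2Class Ω ua - l2Class Ω uh) =
      l2Class Ω u - l2Class Ω uh := by
    rw [r1, r3]
    abel
  -- Both sides equal `uf - ufh`: the function `qh` cancels between `ufa = ua - qh` and `ufh = uh -
  -- qh`. The remaining `q` provides the term `(q - qa, p)` in the control equation.
  have dctrl : l2Class Ω uf - l2Class Ω ufa + (l2Class Ω ua - l2Class Ω uh) =
      l2Class Ω u - l2Class Ω q - l2Class Ω ufh := by
    rw [r1, r2, r3]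
    abel
  obtain ⟨k1, k2, k3, k4, k5, k6⟩ := hstab (l2Class Ω q - l2Class Ω qa) (l2Class Ω uf - l2Class Ω ufa)
    (l2Class Ω φ - l2Class Ω φa) (M.lapClass q - M.lapClass qa) (M.lapClass uf - M.lapClass ufa)
    (M.lapClass φ - M.lapClass φa) (l2Class Ω qa - l2Class Ω qh) (l2Class Ω ua - l2Class Ω uh)
    (M.lapClass qa - M.lapClass qh) (M.lapClass φa - M.lapClass φh) δ
    (by simp only [inner_sub_left, inner_sub_right]; linear_combination s1 - s2)
    (by simp only [inner_sub_left, inner_sub_right]; linear_combination s3 - s4)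
    (by rw [dsum]; simp only [inner_sub_left, inner_sub_right]; linear_combination a1 - a2)
    (by rw [dsum]; simp only [inner_sub_left, inner_sub_right]; linear_combination a3 - a4)
    (by rw [dctrl]; simp only [inner_sub_left, inner_sub_right]; linear_combination c1 - c2)
    pf pφ (by linarith) (by linarith) (by linarith) (by linarith)
  have t1 : ‖l2Class Ω q - l2Class Ω qh‖ ≤ (K + 1) * δ := by
    have := norm_add_le (l2Class Ω q - l2Class Ω qa) (l2Class Ω qa - l2Class Ω qh)
    rw [sub_add_sub_cancel] at this
    linarith
  have t2 : ‖M.lapClass q - M.lapClass qh‖ ≤ (K + 1) * δ := by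
    have := norm_add_le (M.lapClass q - M.lapClass qa) (M.lapClass qa - M.lapClass qh)
    rw [sub_add_sub_cancel] at this
    linarith
  have t3 : ‖l2Class Ω φ - l2Class Ω φh‖ ≤ (K + 1) * δ := by
    have := norm_add_le (l2Class Ω φ - l2Class Ω φa) (l2Class Ω φa - l2Class Ω φh)
    rw [sub_add_sub_cancel] at this
    linarith
  have t4 : ‖M.lapClass φ - M.lapClass φh‖ ≤ (K + 1) * δ := by
    have := norm_add_le (M.lapClass φ - M.lapClass φa) (M.lapClass φa - M.lapClass φh)
    rw [sub_add_sub_cancel] at this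
    linarith
  have t5 : ‖l2Class Ω u - l2Class Ω uh‖ ≤ (2 * K + 2) * δ := by
    -- Since `u = uf + q` and `ua = ufa + qh`, the error of the state splits into those of `uf` and
    -- `q` and the perturbation `ua - uh`, whence K + (K + 1) + 1.
    have h1 : l2Class Ω u - l2Class Ω uh = l2Class Ω uf - l2Class Ω ufa +
        (l2Class Ω q - l2Class Ω qh) + (l2Class Ω ua - l2Class Ω uh) := by
      rw [r1, r3]
      abel
    rw [h1]
    linarith [norm_add₃_le (a := l2Class Ω uf - l2Class Ω ufa) (b := l2Class Ω q - l2Class Ω qh)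
      (c := l2Class Ω ua - l2Class Ω uh)]
  have t6 : ‖M.lapClass u - M.lapClass uh‖ ≤ (2 * K + 2) * δ := by
    have h1 : M.lapClass u - M.lapClass uh = M.lapClass uf - M.lapClass ufa +
        (M.lapClass q - M.lapClass qh) + (M.lapClass ua - M.lapClass uh) := by
      rw [r4, r5]
      abel
    rw [h1]
    linarith [norm_add₃_le (a := M.lapClass uf - M.lapClass ufa) (b := M.lapClass q - M.lapClass qh)
      (c := M.lapClass ua - M.lapClass uh)]
  have hJ : ∀ v, 0 ≤ ∑ e ∈ M.edges, √(σ / edgeLength e) * M.jumpNorm e v := fun v =>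
    Finset.sum_nonneg fun e _ => mul_nonneg (Real.sqrt_nonneg _) (Real.sqrt_nonneg _)
  simp only [mul_add, Finset.sum_add_distrib]
  have j1 := mul_nonneg hK.le (hJ qh)
  have j2 := mul_nonneg hK.le (hJ uh)
  have j3 := mul_nonneg hK.le (hJ φh)
  have j4 := hJ qh
  have j5 := hJ uh
  have j6 := hJ φh
  simp only [hδ] at t1 t2 t3 t4 t5 t6
  linarith
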